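/- **Model.** Let $G$ be a finite directed tree consisting of a reverse multicast tree with root $C$ (leaves: the sources; links directed towards $C$), a link $CD$, and a multicast tree with root $D$ (leaves: the receivers; links directed away from $D$). Write $f(k)$ and $d(k)$ for the parents and children of $k$. Every node of the upper tree that is not a source has at least two parents (coding point), and every node of the lower tree that is not a receiver has at least two children (branching point); $C$ may itself be a source (one source) and $D$ a receiver (one receiver). A link above $C$ is named by its starting point, a link below $D$ by its end point. In an experiment link $e$ works with probability $\alpha_e$, independently of the other links; each source sends its own unit vector, coding points XOR the arriving packets and branching points copy, so coordinate $i$ of the packet at a receiver is $1$ iff the probe of source $i$ arrives there. An outcome $x$ is the family of packets at all receivers, $\Omega$ is the set of outcomes that can occur, and $p(x;\alpha)$ is the probability of $x$. Given counts $n(x)$, $x\in\Omega$, of the outcomes of $n=\sum_x n(x)$ independent experiments, an MLE is a maximizer of $\prod_{x\in\Omega}p(x;\alpha)^{n(x)}$ over $\alpha\in(0,1]^E$. **Algorithm.** For a node $k$ of the lower tree let $\hat\gamma^m_k$ be the proportion of experiments in which some receiver that is $k$ or a descendant of $k$ gets a nonzero packet (the data of the reduced multicast tree, whose aggregate link ends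 at $D$); for a node $k$ of the upper tree let $\hat\gamma^r_k$ be the proportion of experiments in which the probe of some source that is $k$ or an ancestor of $k$ is contained in a received packet (the data of the reduced reverse multicast tree, whose aggregate link starts at $C$). * MINC: $\hat A^m_k=\hat\gamma^m_k$ for receivers $k$; for the other nodes $k$ of the lower tree, $\hat A^m_k$ is the solution in $(\hat\gamma^m_k,\infty)$ of $1-\hat\gamma^m_k/A=\prod_{j\in d(k)}(1-\hat\gamma^m_j/A)$. For $k\ne D$, set $\hat\alpha_k=\hat A^m_k/\hat A^m_{f(k)}$. * RMINC: $\hat A^r_k=\hat\gamma^r_k$ for sources $k$; for the other nodes $k$ of the upper tree, $\hat A^r_k$ is the solution in $(\hat\gamma^r_k,\infty)$ of $1-\hat\gamma^r_k/A=\prod_{j\in f(k)}(1-\hat\gamma^r_j/A)$. For $k\ne C$, set $\hat\alpha_k=\hat A^r_k/\hat A^r_{d(k)}$. * Finally $\hat\alpha_{CD}=\hat A^r_C\,\hat A^m_D/\hat\gamma^m_D$. **Theorem.** 1. If $n(x)>0$ for every $x\in\Omega$, then the equations above have unique solutions in the stated intervals, so that the algorithm computes exactly one vector $\hat\alpha$;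 and if $\hat\alpha\in(0,1]^E$, then $\hat\alpha$ is the MLE, that is, the unique maximizer of the likelihood over $(0,1]^E$. 2. If the true success rates are $\alpha^0\in(0,1)^E$ and the experiments are independent with outcome distribution $p(\cdot\,;\alpha^0)$, then almost surely, for all sufficiently large $n$, the counts after $n$ experiments satisfy $n(x)>0$ for all $x\in\Omega$, the algorithm's output $\hat\alpha$ lies in $(0,1]^E$, and $\hat\alpha$ is the unique MLE. -/

import Mathlib

open MeasureTheory ProbabilityTheory Filter

/-- A finite rooted logical tree, given by the map `next` that moves every node one step towards the
root.  The root is the fixed end of `next`, and a node that is not a leaf has at least two branches.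

It serves for both kinds of trees.  Read downwards it is a *multicast tree*: probes flow from the
root to the leaves, `next k` is the parent of `k`, and the branches of `k` are its children.  Read
upwards it is a *reverse multicast tree*: probes flow from the leaves to the root, `next k` is the
child of `k`, and the branches of `k` are its parents. -/
structure LogicalTree (V : Type*) where
  root : V
  next : V → V
  next_root : next root = root
  reaches_root : ∀ v, ∃ n : ℕ, next^[n] v = root
  logical : ∀ j, j ≠ root → ∃ i, i ≠ root ∧ i ≠ j ∧ next i = next j

namespace LogicalTree

variable {V : Type*}

/-- `j` is a branch of `k`: the node adjacent to `k` on the side away from the root. -/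
def IsBranch (T : LogicalTree V) (j k : V) : Prop := j ≠ T.root ∧ T.next j = k

def IsLeaf (T : LogicalTree V) (k : V) : Prop := ∀ j, ¬ T.IsBranch j k

abbrev Leaf (T : LogicalTree V) : Type _ := {k : V // T.IsLeaf k}

/-- `k` lies on the path from `j` to the root (with `j = k` allowed). -/
def OnPath (T : LogicalTree V) (k j : V) : Prop := ∃ n : ℕ, T.next^[n] j = k

open Classical in
/-- The empirical frequency `γ̂ k`, from the number `c y` of experiments with outcome `y`: the
proportion of experiments in which the probe is recorded (value `true`) for at least one leaf whose
path to the root contains `k`. -/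
noncomputable def freq [Fintype V] (T : LogicalTree V) (c : (T.Leaf → Bool) → ℕ) (k : V) : ℝ :=
  (∑ y : T.Leaf → Bool,
      if ∃ j : T.Leaf, T.OnPath k j ∧ y j = true then (c y : ℝ) else 0) /
    ∑ y : T.Leaf → Bool, (c y : ℝ)

open Classical in
/-- The MINC estimator for a multicast tree and, with the same functional form, the RMINC estimator
for a reverse multicast tree.  The root of `T` is joined by one more link to an extra end node `0`
(the source of the multicast tree, the receiver of the reverse multicast tree); link `k` is the link
at `k` in the direction of `0`, so the links are indexed by all nodes of `T`.

`c` counts the outcomes, `A k` is the estimated probability that the path between `0` and `k` works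
(it is `1` for the end node `0`), and `a k` is the estimated success rate of link `k`. -/
structure IsMINC [Fintype V] (T : LogicalTree V) (c : (T.Leaf → Bool) → ℕ) (A a : V → ℝ) :
    Prop where
  leaf : ∀ k, T.IsLeaf k → A k = T.freq c k
  inner_gt : ∀ k, ¬ T.IsLeaf k → T.freq c k < A k
  inner_eq : ∀ k, ¬ T.IsLeaf k →
    1 - T.freq c k / A k =
      ∏ j ∈ Finset.univ.filter (fun j => T.IsBranch j k), (1 - T.freq c j / A k)
  rate_root : a T.root = A T.root
  rate : ∀ k, k ≠ T.root → a k = A k / A (T.next k)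

end LogicalTree

/-- The multi-source tree: `up` is the part from the sources (its leaves) down to its root `C`, `down`
is the part from its root `D` to the receivers (its leaves), and one link leads from `C` to `D`.  All
coding points are inner nodes of `up`, all branching points are inner nodes of `down`. -/
structure CodedTree (U W : Type*) where
  up : LogicalTree U
  down : LogicalTree W

namespace CodedTree

variable {U W : Type*}

abbrev C (G : CodedTree U W) : U := G.up.root

abbrev D (G : CodedTree U W) : W := G.down.root

abbrev Source (G : CodedTree U W) : Type _ := G.up.Leaf

abbrev Receiver (G : CodedTree U W) : Type _ := G.down.Leaf

/-- The links: those above `C`, named by their starting point, the link `CD`, and those below `D`,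
named by their end point. -/
abbrev Link (G : CodedTree U W) : Type _ := {k : U // k ≠ G.C} ⊕ Unit ⊕ {k : W // k ≠ G.D}

abbrev above (G : CodedTree U W) (k : {k : U // k ≠ G.C}) : G.Link := Sum.inl k

abbrev linkCD (G : CodedTree U W) : G.Link := Sum.inr (Sum.inl ())

abbrev below (G : CodedTree U W) (k : {k : W // k ≠ G.D}) : G.Link := Sum.inr (Sum.inr k)

/-- The starting point of a directed link. -/
def tail (G : CodedTree U W) : G.Link → U ⊕ W
  | Sum.inl k => Sum.inl k
  | Sum.inr (Sum.inl _) => Sum.inl G.C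
  | Sum.inr (Sum.inr k) => Sum.inr (G.down.next k)

/-- The end point of a directed link. -/
def head (G : CodedTree U W) : G.Link → U ⊕ W
  | Sum.inl k => Sum.inl (G.up.next k)
  | Sum.inr (Sum.inl _) => Sum.inr G.D
  | Sum.inr (Sum.inr k) => Sum.inr k

/-- A probe at node `v` arrives at node `v'` when exactly the links with `w e = true` work. -/
def Arrives (G : CodedTree U W) (w : G.Link → Bool) : U ⊕ W → U ⊕ W → Prop :=
  Relation.ReflTransGen (fun v v' => ∃ e : G.Link, w e = true ∧ G.tail e = v ∧ G.head e = v')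

open Classical in
/-- The packets at the receivers.  Source `s` sends the unit vector of `s`, coding points XOR the
packets that arrive, and branching points copy.  The packets that meet at a coding point come from
disjoint sets of sources, so nothing cancels: coordinate `s` of the packet at a node tells
whether the probe of source `s` arrives there. -/
noncomputable def observation (G : CodedTree U W) (w : G.Link → Bool) :
    G.Receiver → G.Source → Bool :=
  fun r s => decide (G.Arrives w (Sum.inl s.1) (Sum.inr r.1))

/-- The possible outcomes of an experiment. -/
abbrev Outcome (G : CodedTree U W) : Type _ :=
  {x : G.Receiver → G.Source → Bool // ∃ w, G.observation w = x}

open Classical in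
/-- The probability `p(x; α)` of outcome `x`, where the links `e` work independently with
probability `α e`. -/
noncomputable def prob [Fintype U] [Fintype W] (G : CodedTree U W) (α : G.Link → ℝ)
    (x : G.Outcome) : ℝ :=
  ∑ w : G.Link → Bool,
    if G.observation w = x.1 then ∏ e : G.Link, (if w e = true then α e else 1 - α e) else 0

open Classical in
/-- The probability of the data, with `N x` experiments of outcome `x`. -/
noncomputable def likelihood [Fintype U] [Fintype W] (G : CodedTree U W) (N : G.Outcome → ℕ)
    (α : G.Link → ℝ) : ℝ :=
  ∏ x : G.Outcome, G.prob α x ^ N x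

/-- The parameter space `(0,1]^E`. -/
def rates (G : CodedTree U W) : Set (G.Link → ℝ) := {α | ∀ e, 0 < α e ∧ α e ≤ 1}

/-- `α` is a maximum likelihood estimate. -/
def IsMLE [Fintype U] [Fintype W] (G : CodedTree U W) (N : G.Outcome → ℕ) (α : G.Link → ℝ) :
    Prop :=
  α ∈ G.rates ∧ ∀ β ∈ G.rates, G.likelihood N β ≤ G.likelihood N α

open Classical in
/-- The outcome counts of the reduced multicast tree: all that is kept of an outcome is which
receivers got a nonzero packet. -/
noncomputable def multicastCount [Fintype U] [Fintype W] (G : CodedTree U W)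
    (N : G.Outcome → ℕ) (y : G.Receiver → Bool) : ℕ :=
  ∑ x : G.Outcome, if ∀ r, y r = true ↔ ∃ s, x.1 r s = true then N x else 0

open Classical in
/-- The outcome counts of the reduced reverse multicast tree: all that is kept of an outcome is which
sources' probes got through to some receiver. -/
noncomputable def reverseCount [Fintype U] [Fintype W] (G : CodedTree U W)
    (N : G.Outcome → ℕ) (y : G.Source → Bool) : ℕ :=
  ∑ x : G.Outcome, if ∀ s, y s = true ↔ ∃ r, x.1 r s = true then N x else 0

/-- `α` is what the algorithm computes from the data: MINC on the reduced multicast tree (the part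
below `D`, with an aggregate link into `D`), RMINC on the reduced reverse multicast tree (the part
above `C`, with an aggregate link out of `C`), and `A^r_C * A^m_D / γ^m_D` for the link `CD`. -/
def IsAlgorithmOutput [Fintype U] [Fintype W] (G : CodedTree U W) (N : G.Outcome → ℕ)
    (α : G.Link → ℝ) : Prop :=
  ∃ (Am am : W → ℝ) (Ar ar : U → ℝ),
    G.down.IsMINC (G.multicastCount N) Am am ∧
    G.up.IsMINC (G.reverseCount N) Ar ar ∧
    (∀ k, α (G.below k) = am k.1) ∧
    (∀ k, α (G.above k) = ar k.1) ∧
    α G.linkCD = Ar G.C * Am G.D / G.down.freq (G.multicastCount N) G.D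

open Classical in
/-- The number of occurrences of each outcome among the first `n` of a sequence of experiments. -/
noncomputable def counts (G : CodedTree U W) (X : ℕ → G.Outcome) (n : ℕ) (x : G.Outcome) : ℕ :=
  ((Finset.range n).filter (fun t => X t = x)).card

end CodedTree

/-! Call a node hit by an outcome if some leaf at or beyond it (seen from the root of its tree) is
marked: a source whose probe gets through, or a receiver with a nonzero packet. The numbers γ̂ are
the frequencies of hits, and they are all that the likelihood sees. Indeed, a nonzero outcome is
determined by its marked sources and marked receivers, and its probability is an upper factor times
α_CD times a lower factor (`prob_of_ne_zero`). Each tree factor is a product over the non-root nodes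
(`patternProb_of_hit`), so the logarithm of the probability is affine in the hit indicators
(`log_prob`), and averages of it depend on the weights only through their total and the hit
frequencies (`sum_mul_log_prob`).

The algorithm is the method of moments for these statistics: under p(·; α̂) the expected hit
frequencies are exactly γ̂ (`IsOutputFor.hitFreq_eq`). Hence the empirical weights may be exchanged
for p(·; α̂), and the log-likelihood of a β giving every outcome positive probability is n ∑ p(x;
α̂) log p(x; β). By Gibbs' inequality (`sum_mul_log_le`) this is maximal exactly when p(·; β) = p(·;
α̂). Such a β solves the equations of the algorithm for the same frequencies (`isOutputFor_prob`),
so β = α̂ by uniqueness of the solution.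

Solvability at a node k rests on A ↦ A(1 - ∏(1 - γ_j/A)): it is strictly increasing for A > γ_k, is
smaller than γ_k at A = γ_k, and eventually exceeds γ_k because γ_k < ∑ γ_j. The strict inequalities
needed between the γ hold because every outcome has positive weight (`Regular`, `regular_hitFreq`).

The same monotonicity makes the output continuous in the frequencies (`tendsto_output`). By the
strong law the empirical distribution tends to p(·; α⁰), for which the output is α⁰ itself; since α⁰
is interior to the cube, the outputs eventually lie in the cube, and the deterministic part applies.
-/

namespace LogicalTree

/-! ### Rooted trees: paths, branches and induction in both directions -/

variable {V : Type*} (T : LogicalTree V)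

open Classical in
/-- The number of steps from a node to the root. -/
noncomputable def depth (k : V) : ℕ := Nat.find (T.reaches_root k)

theorem depth_next {j : V} (hj : j ≠ T.root) : T.depth j = T.depth (T.next j) + 1 := by
  classical
  exact Nat.find_comp_succ (T.reaches_root j) (T.reaches_root (T.next j)) hj

theorem depth_next_le (j : V) : T.depth (T.next j) ≤ T.depth j := by
  by_cases hj : j = T.root
  · rw [hj, T.next_root]
  · rw [T.depth_next hj]; exact Nat.le_succ _

theorem onPath_refl (k : V) : T.OnPath k k := ⟨0, rfl⟩

theorem onPath_next (k : V) : T.OnPath (T.next k) k := ⟨1, rfl⟩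

theorem onPath_root (k : V) : T.OnPath T.root k := T.reaches_root k

variable {T}

theorem OnPath.trans {i k j : V} (h : T.OnPath i k) (h' : T.OnPath k j) : T.OnPath i j := by
  obtain ⟨n, rfl⟩ := h
  obtain ⟨m, rfl⟩ := h'
  exact ⟨n + m, Function.iterate_add_apply _ _ _ _⟩

theorem onPath_iff {k j : V} : T.OnPath k j ↔ k = j ∨ T.OnPath k (T.next j) := by
  constructor
  · rintro ⟨n, rfl⟩
    cases n with
    | zero => exact Or.inl rfl
    | succ n => exact Or.inr ⟨n, rfl⟩
  · rintro (rfl | h)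
    · exact T.onPath_refl _
    · exact h.trans (T.onPath_next j)

theorem OnPath.depth_le {k j : V} (h : T.OnPath k j) : T.depth k ≤ T.depth j := by
  obtain ⟨n, rfl⟩ := h
  induction n generalizing j with
  | zero => exact le_rfl
  | succ n ih => exact (ih (j := T.next j)).trans (T.depth_next_le j)

theorem OnPath.eq_root {k : V} (h : T.OnPath k T.root) : k = T.root := by
  obtain ⟨n, rfl⟩ := h
  exact Function.iterate_fixed T.next_root n

theorem OnPath.eq_of_depth_le {k j : V} (h : T.OnPath k j) (hd : T.depth j ≤ T.depth k) :
    k = j := by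
  by_cases hj : j = T.root
  · subst hj; exact h.eq_root
  · rcases onPath_iff.1 h with h | h
    · exact h
    · have := h.depth_le
      have := T.depth_next hj
      omega

theorem OnPath.antisymm {k j : V} (h : T.OnPath k j) (h' : T.OnPath j k) : k = j :=
  h.eq_of_depth_le h'.depth_le

theorem OnPath.total {i i' j : V} (h : T.OnPath i j) (h' : T.OnPath i' j) :
    T.OnPath i i' ∨ T.OnPath i' i := by
  obtain ⟨n, rfl⟩ := h
  obtain ⟨m, rfl⟩ := h'
  rcases le_total n m with hnm | hnm
  · obtain ⟨d, rfl⟩ := Nat.exists_eq_add_of_le hnm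
    exact Or.inr ⟨d, by rw [← Function.iterate_add_apply, add_comm]⟩
  · obtain ⟨d, rfl⟩ := Nat.exists_eq_add_of_le hnm
    exact Or.inl ⟨d, by rw [← Function.iterate_add_apply, add_comm]⟩

theorem IsBranch.onPath {j k : V} (h : T.IsBranch j k) : T.OnPath k j := ⟨1, h.2⟩

theorem IsBranch.depth {j k : V} (h : T.IsBranch j k) : T.depth j = T.depth k + 1 := by
  rw [T.depth_next h.1, h.2]

theorem IsBranch.not_onPath {j k : V} (h : T.IsBranch j k) : ¬ T.OnPath j k := fun h' => by
  have := h'.depth_le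
  have := h.depth
  omega

theorem IsBranch.ne {j k : V} (h : T.IsBranch j k) : j ≠ k := fun e =>
  h.not_onPath (e ▸ T.onPath_refl _)

theorem IsBranch.onPath_of_ne {j k i : V} (h : T.IsBranch j k) (hi : T.OnPath i j) (hne : i ≠ j) :
    T.OnPath i k := by
  rcases onPath_iff.1 hi with e | e
  · exact absurd e hne
  · rwa [h.2] at e

theorem OnPath.exists_branch {k j : V} (h : T.OnPath k j) (hne : j ≠ k) :
    ∃ i, T.IsBranch i k ∧ T.OnPath i j := by
  obtain ⟨n, rfl⟩ := h
  induction n generalizing j with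
  | zero => exact absurd rfl hne
  | succ n ih =>
    by_cases hj : T.next j = T.next^[n] (T.next j)
    · refine ⟨j, ⟨?_, hj⟩, T.onPath_refl j⟩
      rintro rfl
      exact hne (Function.iterate_fixed T.next_root (n + 1)).symm
    · obtain ⟨i, hi, hij⟩ := ih hj
      exact ⟨i, hi, hij.trans (T.onPath_next j)⟩

theorem IsBranch.eq_of_onPath {i i' k j : V} (h : T.IsBranch i k) (h' : T.IsBranch i' k)
    (hj : T.OnPath i j) (hj' : T.OnPath i' j) : i = i' := by
  have := h.depth
  have := h'.depth
  rcases hj.total hj' with e | e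
  · exact e.eq_of_depth_le (by omega)
  · exact (e.eq_of_depth_le (by omega)).symm

theorem IsLeaf.eq_of_onPath {k j : V} (h : T.IsLeaf k) (hj : T.OnPath k j) : j = k := by
  by_contra hne
  obtain ⟨i, hi, -⟩ := hj.exists_branch hne
  exact h i hi

theorem IsBranch.exists_sibling {j k : V} (h : T.IsBranch j k) : ∃ i, i ≠ j ∧ T.IsBranch i k := by
  obtain ⟨i, h1, h2, h3⟩ := T.logical j h.1
  exact ⟨i, h2, h1, h3.trans h.2⟩

/-- Depth is bounded on a finite tree and grows by one at each branch, so the bound minus the depth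
is a measure for induction from the leaves. -/
theorem branch_induction [Finite V] {P : V → Prop}
    (h : ∀ k, (∀ j, T.IsBranch j k → P j) → P k) (k : V) : P k := by
  obtain ⟨B, hB⟩ := (Set.finite_range T.depth).bddAbove
  have hB : ∀ j, T.depth j ≤ B := fun j => hB ⟨j, rfl⟩
  have key : ∀ n k, B - T.depth k ≤ n → P k := by
    intro n
    induction n with
    | zero =>
      intro k hk
      refine h k fun j hj => ?_
      have := hj.depth
      have := hB j
      omega
    | succ n ih =>
      intro k hk
      refine h k fun j hj => ih j ?_
      have := hj.depth
      have := hB j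
      omega
  exact key _ k le_rfl

theorem root_induction {P : V → Prop} (h0 : P T.root)
    (h : ∀ k, k ≠ T.root → P (T.next k) → P k) (k : V) : P k := by
  obtain ⟨n, hn⟩ := T.reaches_root k
  induction n generalizing k with
  | zero => rwa [← hn] at h0
  | succ n ih =>
    by_cases hk : k = T.root
    · rwa [hk]
    · exact h k hk (ih _ hn)

variable (T) in
theorem exists_leaf [Finite V] (k : V) : ∃ l : T.Leaf, T.OnPath k l := by
  induction k using branch_induction (T := T) with
  | h k ih =>
    by_cases hk : T.IsLeaf k
    · exact ⟨⟨k, hk⟩, T.onPath_refl k⟩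
    · simp only [IsLeaf, not_forall, not_not] at hk
      obtain ⟨j, hj⟩ := hk
      obtain ⟨l, hl⟩ := ih j hj
      exact ⟨l, hj.onPath.trans hl⟩

variable [Fintype V]

open Classical in
/-- The branches of a node. -/
noncomputable def branches (T : LogicalTree V) (k : V) : Finset V :=
  Finset.univ.filter fun j => T.IsBranch j k

theorem mem_branches {j k : V} : j ∈ T.branches k ↔ T.IsBranch j k := by
  simp [branches]

theorem exists_branches {k : V} (hk : ¬ T.IsLeaf k) :
    ∃ i ∈ T.branches k, ∃ j ∈ T.branches k, i ≠ j := by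
  simp only [IsLeaf, not_forall, not_not] at hk
  obtain ⟨j, hj⟩ := hk
  obtain ⟨i, hij, hi⟩ := hj.exists_sibling
  exact ⟨i, mem_branches.2 hi, j, mem_branches.2 hj, hij⟩

open Classical in
/-- The nodes strictly beyond `k`, as seen from the root. -/
noncomputable def beyond (T : LogicalTree V) (k : V) : Finset V :=
  Finset.univ.filter fun j => T.OnPath k j ∧ j ≠ k

theorem mem_beyond {j k : V} : j ∈ T.beyond k ↔ T.OnPath k j ∧ j ≠ k := by
  simp [beyond]

theorem beyond_leaf {k : V} (hk : T.IsLeaf k) : T.beyond k = ∅ := by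
  ext j
  simp only [mem_beyond, Finset.notMem_empty, iff_false, not_and, not_not]
  exact hk.eq_of_onPath

/-- The nodes beyond k fall into disjoint subtrees, one for each branch. This turns a recursion over
branches into a closed product. -/
theorem prod_beyond (k : V) (f : V → ℝ) :
    ∏ i ∈ T.beyond k, f i = ∏ j ∈ T.branches k, (f j * ∏ i ∈ T.beyond j, f i) := by
  classical
  have hnot : ∀ j, j ∉ T.beyond j := fun j h => (mem_beyond.1 h).2 rfl
  have hU : T.beyond k = (T.branches k).biUnion fun j => insert j (T.beyond j) := by
    ext i
    simp only [Finset.mem_biUnion, Finset.mem_insert, mem_beyond, mem_branches]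
    constructor
    · rintro ⟨h, hne⟩
      obtain ⟨j, hj, hji⟩ := h.exists_branch hne
      exact ⟨j, hj, or_iff_not_imp_left.2 fun h => ⟨hji, h⟩⟩
    · rintro ⟨j, hj, hij⟩
      have hji : T.OnPath j i := hij.elim (fun e => e ▸ T.onPath_refl _) And.left
      refine ⟨hj.onPath.trans hji, ?_⟩
      rintro rfl
      exact hj.not_onPath hji
  rw [hU, Finset.prod_biUnion]
  · exact Finset.prod_congr rfl fun j _ => Finset.prod_insert (hnot j)
  · intro j hj j' hj' hne
    refine Finset.disjoint_left.2 fun i hi hi' => hne ?_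
    have aux : ∀ {j}, i ∈ insert j (T.beyond j) → T.OnPath j i := fun {j} h =>
      (Finset.mem_insert.1 h).elim (fun e => e ▸ T.onPath_refl _) fun h => (mem_beyond.1 h).1
    exact (mem_branches.1 hj).eq_of_onPath (mem_branches.1 hj') (aux hi) (aux hi')

end LogicalTree

/-! ### Indicators and expectations over independent links -/

open Classical in
/-- The indicator of a proposition. -/
noncomputable def ind (P : Prop) : ℝ := if P then 1 else 0

theorem ind_true {P : Prop} (h : P) : ind P = 1 := if_pos h

theorem ind_false {P : Prop} (h : ¬ P) : ind P = 0 := if_neg h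

theorem ind_and (P Q : Prop) : ind (P ∧ Q) = ind P * ind Q := by
  by_cases hP : P <;> by_cases hQ : Q <;> simp [ind, hP, hQ]

theorem ind_not (P : Prop) : ind (¬ P) = 1 - ind P := by
  by_cases hP : P <;> simp [ind, hP]

theorem ind_nonneg (P : Prop) : 0 ≤ ind P := by
  by_cases hP : P <;> simp [ind, hP]

theorem ind_mono {P Q : Prop} (h : P → Q) : ind P ≤ ind Q := by
  by_cases hP : P
  · rw [ind_true hP, ind_true (h hP)]
  · rw [ind_false hP]; exact ind_nonneg Q

theorem ind_forall {ι : Type*} (s : Finset ι) (P : ι → Prop) :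
    ind (∀ i ∈ s, P i) = ∏ i ∈ s, ind (P i) := by
  by_cases h : ∀ i ∈ s, P i
  · rw [ind_true h, Finset.prod_eq_one fun i hi => ind_true (h i hi)]
  · rw [ind_false h]
    push Not at h
    obtain ⟨i, hi, hP⟩ := h
    rw [Finset.prod_eq_zero hi (ind_false hP)]

theorem dependsOn_coord {E : Type*} (e : E) : DependsOn (fun w : E → Bool => ind (w e = true)) {e} :=
  fun w w' hw => by simp only [hw e rfl]

theorem DependsOn.comp₂ {E : Type*} {X Y Z : Type*} {f : (E → Bool) → X} {g : (E → Bool) → Y}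
    {s t : Set E} (hf : DependsOn f s) (hg : DependsOn g t) (h : X → Y → Z) :
    DependsOn (fun w => h (f w) (g w)) (s ∪ t) := fun w w' hw => by
  simp only [hf fun i hi => hw i (Or.inl hi), hg fun i hi => hw i (Or.inr hi)]

section Expectation

variable {E : Type*} [Fintype E] (p : E → ℝ)

/-- The probability of a configuration of independent links with rates `p`. -/
def linkWeight (w : E → Bool) : ℝ := ∏ e, if w e = true then p e else 1 - p e

open Classical in
/-- The expectation of `f` over independent links with rates `p`. -/
noncomputable def expect (f : (E → Bool) → ℝ) : ℝ := ∑ w, linkWeight p w * f w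

theorem sum_linkWeight [DecidableEq E] : ∑ w : E → Bool, linkWeight p w = 1 := by
  have := Finset.prod_univ_sum (fun _ : E => (Finset.univ : Finset Bool))
    (fun e b => if b = true then p e else 1 - p e)
  simp only [Fintype.piFinset_univ] at this
  simp only [linkWeight]
  rw [← this]
  simp

theorem expect_one : expect p (fun _ => 1) = 1 := by
  classical
  simp only [expect, mul_one]
  convert sum_linkWeight p

theorem expect_sub (f g : (E → Bool) → ℝ) :
    expect p (fun w => f w - g w) = expect p f - expect p g := by
  simp only [expect, mul_sub, Finset.sum_sub_distrib]

theorem expect_add (f g : (E → Bool) → ℝ) :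
    expect p (fun w => f w + g w) = expect p f + expect p g := by
  simp only [expect, mul_add, Finset.sum_add_distrib]

theorem expect_mul_const (f : (E → Bool) → ℝ) (c : ℝ) :
    expect p (fun w => f w * c) = expect p f * c := by
  simp only [expect, ← mul_assoc, Finset.sum_mul]

variable {p} in
theorem linkWeight_nonneg (hp : ∀ e, 0 ≤ p e ∧ p e ≤ 1) (w : E → Bool) : 0 ≤ linkWeight p w :=
  Finset.prod_nonneg fun e _ => by
    split_ifs
    · exact (hp e).1
    · exact sub_nonneg.2 (hp e).2

theorem expect_nonneg (hp : ∀ e, 0 ≤ p e ∧ p e ≤ 1) {f : (E → Bool) → ℝ} (hf : ∀ w, 0 ≤ f w) :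
    0 ≤ expect p f :=
  Finset.sum_nonneg fun w _ => mul_nonneg (linkWeight_nonneg hp w) (hf w)

/-- Independence of functions of disjoint sets of links. It is a polynomial identity in the rates,
so no bounds on p are needed. -/
theorem expect_mul {f g : (E → Bool) → ℝ} {s t : Set E} (hf : DependsOn f s) (hg : DependsOn g t)
    (hst : Disjoint s t) :
    expect p (fun w => f w * g w) = expect p f * expect p g := by
  classical
  let e := Equiv.piEquivPiSubtypeProd (fun x => x ∈ s) (fun _ : E => Bool)
  let p₁ : {x // x ∈ s} → ℝ := fun x => p x
  let p₂ : {x // x ∉ s} → ℝ := fun x => p x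
  -- The coordinates that f and g ignore are filled with an arbitrary value.
  let f' : ({x // x ∈ s} → Bool) → ℝ := fun a => f (e.symm (a, fun _ => false))
  let g' : ({x // x ∉ s} → Bool) → ℝ := fun b => g (e.symm (fun _ => false, b))
  have hw : ∀ a b, linkWeight p (e.symm (a, b)) = linkWeight p₁ a * linkWeight p₂ b := by
    intro a b
    simp only [linkWeight]
    rw [← Fintype.prod_subtype_mul_prod_subtype (fun x => x ∈ s)]
    congr 1
    · refine Finset.prod_congr rfl fun x _ => ?_
      have : e.symm (a, b) x = a x := by simp [e, Equiv.piEquivPiSubtypeProd, x.2]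
      rw [this]
    · refine Finset.prod_congr rfl fun x _ => ?_
      have : e.symm (a, b) x = b x := by simp [e, Equiv.piEquivPiSubtypeProd, x.2]
      rw [this]
  have hf' : ∀ a b, f (e.symm (a, b)) = f' a := fun a b => hf fun x hx => by
    simp [e, Equiv.piEquivPiSubtypeProd, hx]
  have hg' : ∀ a b, g (e.symm (a, b)) = g' b := fun a b => hg fun x hx => by
    have hx : x ∉ s := fun h => Set.disjoint_left.1 hst h hx
    simp [e, Equiv.piEquivPiSubtypeProd, hx]
  have key : ∀ h : (E → Bool) → ℝ, expect p h =
      ∑ a, ∑ b, linkWeight p₁ a * linkWeight p₂ b * h (e.symm (a, b)) := by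
    intro h
    rw [← Fintype.sum_prod_type', expect, ← Equiv.sum_comp e.symm]
    · refine (Finset.sum_congr (by ext; simp) fun x _ => ?_)
      rw [← hw]
  have h1 : expect p f = ∑ a, linkWeight p₁ a * f' a := by
    rw [key]
    refine Finset.sum_congr rfl fun a _ => ?_
    simp only [hf', mul_right_comm _ _ (f' a)]
    rw [← Finset.mul_sum, sum_linkWeight, mul_one]
  have h2 : expect p g = ∑ b, linkWeight p₂ b * g' b := by
    rw [key, Finset.sum_comm]
    refine Finset.sum_congr rfl fun b _ => ?_
    simp only [hg', mul_assoc]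
    rw [← Finset.sum_mul, sum_linkWeight, one_mul]
  rw [h1, h2, key, Finset.sum_mul_sum]
  refine Finset.sum_congr rfl fun a _ => Finset.sum_congr rfl fun b _ => ?_
  rw [hf', hg']
  ring

theorem expect_prod {ι : Type*} (I : Finset ι) (f : ι → (E → Bool) → ℝ) (s : ι → Set E)
    (hf : ∀ i ∈ I, DependsOn (f i) (s i))
    (hs : ∀ i ∈ I, ∀ j ∈ I, i ≠ j → Disjoint (s i) (s j)) :
    expect p (fun w => ∏ i ∈ I, f i w) = ∏ i ∈ I, expect p (f i) := by
  classical
  induction I using Finset.induction_on with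
  | empty => simp [expect_one]
  | insert a I ha ih =>
    simp only [Finset.prod_insert ha]
    have hd : DependsOn (fun w => ∏ i ∈ I, f i w) (⋃ i ∈ I, s i) := fun w w' hw =>
      Finset.prod_congr rfl fun i hi =>
        hf i (Finset.mem_insert_of_mem hi) fun x hx => hw x (Set.mem_biUnion hi hx)
    rw [expect_mul p (hf a (Finset.mem_insert_self a I)) hd, ih]
    · exact fun i hi => hf i (Finset.mem_insert_of_mem hi)
    · exact fun i hi j hj => hs i (Finset.mem_insert_of_mem hi) j (Finset.mem_insert_of_mem hj)
    · simp only [Set.disjoint_iUnion_right]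
      exact fun i hi => hs a (Finset.mem_insert_self a I) i (Finset.mem_insert_of_mem hi)
        (fun e => ha (e ▸ hi))

theorem expect_coord (e : E) : expect p (fun w => ind (w e = true)) = p e := by
  classical
  have := Finset.prod_univ_sum (fun _ : E => (Finset.univ : Finset Bool))
    (fun i b => (if b = true then p i else 1 - p i) * if i = e then ind (b = true) else 1)
  simp only [Fintype.piFinset_univ, Finset.prod_mul_distrib, Finset.prod_ite_eq',
    Finset.mem_univ, if_true] at this
  have h2 : expect p (fun w => ind (w e = true)) =
      ∑ w : E → Bool, (∏ i, if w i = true then p i else 1 - p i) * ind (w e = true) := by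
    simp only [expect, linkWeight]
  rw [h2, ← this, Finset.prod_eq_single e]
  · simp [ind]
  · intro b _ hb
    simp [hb]
  · simp

end Expectation

/-! ### Bounds for ∏(1 - x_j) -/

section Products

variable {ι : Type*} {S : Finset ι} {x : ι → ℝ}

/-- This is weaker than ∏(1 - x_j)(1 + x_j) ≤ 1, as 1 + ∑ x_j ≤ ∏(1 + x_j). It gives both the strict
bound of the product by 1 and the upper end point in `exists_mincFun_eq`. -/
theorem prod_one_sub_mul_one_add_sum_le (h0 : ∀ j ∈ S, 0 ≤ x j) (h1 : ∀ j ∈ S, x j ≤ 1) :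
    (∏ j ∈ S, (1 - x j)) * (1 + ∑ j ∈ S, x j) ≤ 1 := by
  classical
  induction S using Finset.induction_on with
  | empty => simp
  | insert a S ha ih =>
    rw [Finset.prod_insert ha, Finset.sum_insert ha]
    have h0a := h0 a (Finset.mem_insert_self a S)
    have h0' : ∀ j ∈ S, 0 ≤ x j := fun j hj => h0 j (Finset.mem_insert_of_mem hj)
    have h1' : ∀ j ∈ S, x j ≤ 1 := fun j hj => h1 j (Finset.mem_insert_of_mem hj)
    have ih := ih h0' h1'
    have hs : 0 ≤ ∑ j ∈ S, x j := Finset.sum_nonneg h0'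
    have hP : 0 ≤ ∏ j ∈ S, (1 - x j) := Finset.prod_nonneg fun j hj => sub_nonneg.2 (h1' j hj)
    nlinarith [mul_nonneg hP (mul_nonneg h0a h0a), mul_nonneg hP (mul_nonneg h0a hs)]

theorem prod_one_sub_lt_one (h0 : ∀ j ∈ S, 0 < x j) (h1 : ∀ j ∈ S, x j ≤ 1) (hS : S.Nonempty) :
    ∏ j ∈ S, (1 - x j) < 1 := by
  have h := prod_one_sub_mul_one_add_sum_le (fun j hj => (h0 j hj).le) h1
  have hs : 0 < ∑ j ∈ S, x j := Finset.sum_pos h0 hS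
  have hP : 0 ≤ ∏ j ∈ S, (1 - x j) := Finset.prod_nonneg fun j hj => sub_nonneg.2 (h1 j hj)
  by_contra hc
  nlinarith

theorem prod_one_sub_le_one (h0 : ∀ j ∈ S, 0 ≤ x j) (h1 : ∀ j ∈ S, x j ≤ 1) :
    ∏ j ∈ S, (1 - x j) ≤ 1 :=
  Finset.prod_le_one (fun j hj => sub_nonneg.2 (h1 j hj)) fun j hj => sub_le_self _ (h0 j hj)

end Products

/-! ### Connection patterns of leaves and their probabilities -/

namespace LogicalTree

section Patterns

variable {V : Type*} (T : LogicalTree V)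

/-- All links on the path from `l` to `k` work, not counting the link at `k`. -/
def Conn (s : V → Bool) (k l : V) : Prop :=
  ∀ i, T.OnPath k i → T.OnPath i l → i ≠ k → s i = true

/-- Among the leaves beyond `k`, those connected to `k` are those marked by `y`. -/
def Pattern (y : T.Leaf → Bool) (s : V → Bool) (k : V) : Prop :=
  ∀ l : T.Leaf, T.OnPath k l → (T.Conn s k l ↔ y l = true)

/-- Some leaf whose path to the root contains `k` is marked by `y`. -/
def Hit (y : T.Leaf → Bool) (k : V) : Prop := ∃ l : T.Leaf, T.OnPath k l ∧ y l = true

variable {T}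

theorem conn_self (s : V → Bool) (k : V) : T.Conn s k k := fun _ h h' hne =>
  absurd (h'.antisymm h) hne

theorem IsBranch.conn_iff {j k l : V} (h : T.IsBranch j k) (hl : T.OnPath j l) (s : V → Bool) :
    T.Conn s k l ↔ s j = true ∧ T.Conn s j l := by
  constructor
  · refine fun hc => ⟨hc j h.onPath hl h.ne, fun i hi hil _ => hc i (h.onPath.trans hi) hil ?_⟩
    rintro rfl
    exact h.not_onPath hi
  · rintro ⟨hj, hc⟩ i hki hil hne
    by_cases hij : i = j
    · rwa [hij]
    · rcases hil.total hl with e | e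
      · exact absurd ((h.onPath_of_ne e hij).antisymm hki) hne
      · exact hc i e hil hij

theorem conn_root_iff {k : V} (hk : k ≠ T.root) (s : V → Bool) :
    T.Conn s T.root k ↔ s k = true ∧ T.Conn s T.root (T.next k) := by
  constructor
  · exact fun hc => ⟨hc k (T.onPath_root k) (T.onPath_refl k) hk, fun i hi hik hne =>
      hc i hi (hik.trans (T.onPath_next k)) hne⟩
  · rintro ⟨hs, hc⟩ i hi hik hne
    rcases onPath_iff.1 hik with rfl | e
    · exact hs
    · exact hc i hi e hne

theorem conn_trans_iff {i k l : V} (hik : T.OnPath i k) (hkl : T.OnPath k l) (s : V → Bool) :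
    T.Conn s i l ↔ T.Conn s i k ∧ T.Conn s k l := by
  constructor
  · refine fun h => ⟨fun j hj hjk => h j hj (hjk.trans hkl), fun j hj hjl hne =>
      h j (hik.trans hj) hjl ?_⟩
    rintro rfl
    exact hne (hik.antisymm hj)
  · rintro ⟨h1, h2⟩ j hj hjl hne
    by_cases hjk : T.OnPath j k
    · exact h1 j hj hjk hne
    · exact h2 j ((hkl.total hjl).resolve_right hjk) hjl fun e => hjk (e ▸ T.onPath_refl j)

/-- A leaf is always connected to itself, since `Conn` omits the link at its first node; the pattern
therefore fails exactly when the leaf is unmarked. -/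
theorem pattern_leaf {k : V} (hk : T.IsLeaf k) (y : T.Leaf → Bool) (s : V → Bool) :
    T.Pattern y s k ↔ T.Hit y k := by
  constructor
  · exact fun h => ⟨⟨k, hk⟩, T.onPath_refl k, (h ⟨k, hk⟩ (T.onPath_refl k)).1 (conn_self s k)⟩
  · rintro ⟨l, hl, hy⟩ l' hl'
    have e : l = l' := Subtype.ext ((hk.eq_of_onPath hl).trans (hk.eq_of_onPath hl').symm)
    subst e
    refine iff_of_true ?_ hy
    rw [hk.eq_of_onPath hl]
    exact conn_self s k

theorem IsBranch.hit {j k : V} (h : T.IsBranch j k) {y : T.Leaf → Bool} (hy : T.Hit y j) :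
    T.Hit y k := by
  obtain ⟨l, hl, hy⟩ := hy
  exact ⟨l, h.onPath.trans hl, hy⟩

theorem OnPath.hit {j k : V} (h : T.OnPath k j) {y : T.Leaf → Bool} (hy : T.Hit y j) :
    T.Hit y k := by
  obtain ⟨l, hl, hy⟩ := hy
  exact ⟨l, h.trans hl, hy⟩

theorem not_hit_false (k : V) : ¬ T.Hit (fun _ => false) k := by
  rintro ⟨l, -, h⟩
  exact Bool.false_ne_true h

variable [Fintype V]

theorem hit_branches {k : V} (hk : ¬ T.IsLeaf k) (y : T.Leaf → Bool) :
    T.Hit y k ↔ ∃ j ∈ T.branches k, T.Hit y j := by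
  constructor
  · rintro ⟨l, hl, hy⟩
    obtain ⟨j, hj, hjl⟩ := hl.exists_branch fun e => hk (e ▸ l.2)
    exact ⟨j, mem_branches.2 hj, l, hjl, hy⟩
  · rintro ⟨j, hj, h⟩
    exact (mem_branches.1 hj).hit h

/-- A failed link at a branch cuts off everything beyond it, so no leaf there may be marked; a
working link hands the requirement on to the branch. -/
theorem pattern_iff {k : V} (hk : ¬ T.IsLeaf k) (y : T.Leaf → Bool) (s : V → Bool) :
    T.Pattern y s k ↔ ∀ j ∈ T.branches k,
      (s j = true ∧ T.Pattern y s j) ∨ (s j = false ∧ ¬ T.Hit y j) := by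
  constructor
  · intro h j hj
    have hj := mem_branches.1 hj
    cases hs : s j with
    | true =>
      refine Or.inl ⟨rfl, fun l hl => ?_⟩
      rw [← h l (hj.onPath.trans hl), hj.conn_iff hl, hs]
      simp
    | false =>
      refine Or.inr ⟨rfl, ?_⟩
      rintro ⟨l, hl, hy⟩
      rw [← h l (hj.onPath.trans hl), hj.conn_iff hl, hs] at hy
      exact Bool.false_ne_true hy.1
  · intro h l hl
    obtain ⟨j, hj, hjl⟩ := hl.exists_branch fun e => hk (e ▸ l.2)
    rw [hj.conn_iff hjl]
    rcases h j (mem_branches.2 hj) with ⟨hs, hp⟩ | ⟨hs, hh⟩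
    · rw [hp l hjl]
      simp [hs]
    · simp only [hs, Bool.false_eq_true, false_and, false_iff]
      exact fun hy => hh ⟨l, hjl, hy⟩

end Patterns

section Probabilities

variable {V : Type*} {T : LogicalTree V} {E : Type*} (lk : V → E)

theorem dependsOn_conn (k l : V) :
    DependsOn (fun w : E → Bool => T.Conn (fun i => w (lk i)) k l)
      (lk '' {i | T.OnPath k i ∧ T.OnPath i l ∧ i ≠ k}) := by
  intro w w' h
  refine forall_congr fun i => ?_
  by_cases hi : T.OnPath k i ∧ T.OnPath i l ∧ i ≠ k
  · simp only [h _ ⟨i, hi, rfl⟩]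
  · exact propext ⟨fun _ h1 h2 h3 => absurd ⟨h1, h2, h3⟩ hi, fun _ h1 h2 h3 =>
      absurd ⟨h1, h2, h3⟩ hi⟩

theorem dependsOn_pattern (y : T.Leaf → Bool) (k : V) :
    DependsOn (fun w : E → Bool => T.Pattern y (fun i => w (lk i)) k)
      (lk '' {i | T.OnPath k i ∧ i ≠ k}) := by
  intro w w' h
  refine forall_congr fun l => forall_congr fun _ => ?_
  congr 1
  refine dependsOn_conn lk k l fun e he => h e ?_
  obtain ⟨i, hi, rfl⟩ := he
  exact ⟨i, ⟨hi.1, hi.2.2⟩, rfl⟩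

variable [Fintype E] (p : E → ℝ)

variable (T) in
/-- The probability that the leaves beyond `k` that are connected to `k` are those marked by
`y`. -/
noncomputable def patternProb (y : T.Leaf → Bool) (k : V) : ℝ :=
  expect p fun w => ind (T.Pattern y (fun i => w (lk i)) k)

variable (T) in
/-- The probability that some leaf beyond `k` is connected to `k`. -/
noncomputable def reachProb (k : V) : ℝ := 1 - T.patternProb lk p (fun _ => false) k

theorem patternProb_leaf {k : V} (hk : T.IsLeaf k) (y : T.Leaf → Bool) :
    T.patternProb lk p y k = ind (T.Hit y k) := by
  simp only [patternProb, pattern_leaf hk]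
  have := expect_mul_const p (fun _ => 1) (ind (T.Hit y k))
  simpa only [one_mul, expect_one] using this

theorem reachProb_leaf {k : V} (hk : T.IsLeaf k) : T.reachProb lk p k = 1 := by
  rw [reachProb, patternProb_leaf lk p hk, ind_false (not_hit_false k), sub_zero]

theorem patternProb_of_not_hit {y : T.Leaf → Bool} {k : V} (h : ¬ T.Hit y k) :
    T.patternProb lk p y k = 1 - T.reachProb lk p k := by
  rw [reachProb, sub_sub_cancel, patternProb, patternProb]
  congr 1
  funext w
  congr 1
  refine forall_congr fun l => forall_congr fun hl => ?_
  have : y l = false := by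
    by_contra hy
    exact h ⟨l, hl, by simpa using hy⟩
  rw [this]

variable (T) in
/-- The probability that all links on the path from `k` to the root work, not counting the link at
the root. -/
noncomputable def pathProb (k : V) : ℝ :=
  expect p fun w => ind (T.Conn (fun i => w (lk i)) T.root k)

theorem pathProb_root : T.pathProb lk p T.root = 1 := by
  simp only [pathProb, ind_true (conn_self _ T.root), expect_one]

theorem patternProb_nonneg (hp : ∀ e, 0 ≤ p e ∧ p e ≤ 1) (y : T.Leaf → Bool) (k : V) :
    0 ≤ T.patternProb lk p y k := expect_nonneg p hp fun _ => ind_nonneg _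

theorem reachProb_le_one (hp : ∀ e, 0 ≤ p e ∧ p e ≤ 1) (k : V) : T.reachProb lk p k ≤ 1 :=
  sub_le_self _ (patternProb_nonneg lk p hp _ k)

theorem expect_reach (k : V) :
    (expect p fun w => ind (¬ T.Pattern (fun _ => false) (fun i => w (lk i)) k)) =
      T.reachProb lk p k := by
  simp only [ind_not]
  rw [expect_sub, expect_one, reachProb, patternProb]

variable {lk} (hlk : Function.Injective lk)
include hlk

theorem pathProb_next {k : V} (hk : k ≠ T.root) :
    T.pathProb lk p k = p (lk k) * T.pathProb lk p (T.next k) := by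
  rw [pathProb, pathProb]
  simp only [conn_root_iff hk, ind_and]
  rw [expect_mul p (dependsOn_coord (lk k)) (t := lk '' {i | T.OnPath i (T.next k)})
    (fun w w' hw => congrArg ind (dependsOn_conn lk T.root (T.next k) fun e he => hw e ?_)),
    expect_coord]
  · rw [Set.disjoint_singleton_left]
    rintro ⟨i, hi, e⟩
    obtain rfl := hlk e
    exact IsBranch.not_onPath ⟨hk, rfl⟩ hi
  · obtain ⟨i, hi, rfl⟩ := he
    exact ⟨i, hi.2.1, rfl⟩

/-- The path from the root to k and the subtree beyond k share no links. -/
theorem expect_path_reach (k : V) :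
    (expect p fun w => ind (T.Conn (fun i => w (lk i)) T.root k ∧
      ¬ T.Pattern (fun _ => false) (fun i => w (lk i)) k)) =
      T.pathProb lk p k * T.reachProb lk p k := by
  simp only [ind_and]
  rw [expect_mul p (s := lk '' {i | T.OnPath T.root i ∧ T.OnPath i k ∧ i ≠ T.root})
    (t := lk '' {i | T.OnPath k i ∧ i ≠ k}) (fun w w' h => congrArg ind (dependsOn_conn lk _ k h))
    (fun w w' h => congrArg (fun P => ind (¬ P)) (dependsOn_pattern lk _ k h)), expect_reach,
    pathProb]
  rw [Set.disjoint_image_iff hlk]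
  exact Set.disjoint_left.2 fun i hi hi' => hi'.2 (hi.2.1.antisymm hi'.1)

theorem pathProb_pos (hp : ∀ e, 0 < p e) (k : V) : 0 < T.pathProb lk p k := by
  induction k using root_induction (T := T) with
  | h0 => rw [pathProb_root]; exact one_pos
  | h k hk ih => rw [pathProb_next p hlk hk]; exact mul_pos (hp _) ih

variable [Fintype V]


/-- Different branches involve disjoint sets of links, so the recursion `pattern_iff` becomes a
product. -/
theorem patternProb_inner {k : V} (hk : ¬ T.IsLeaf k) (y : T.Leaf → Bool) :
    T.patternProb lk p y k = ∏ j ∈ T.branches k,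
      (p (lk j) * T.patternProb lk p y j + (1 - p (lk j)) * (1 - ind (T.Hit y j))) := by
  -- The two alternatives at a branch exclude each other, so the indicator of their disjunction is a
  -- sum of products of independent factors.
  let f : V → (E → Bool) → ℝ := fun j w =>
    ind (w (lk j) = true) * ind (T.Pattern y (fun i => w (lk i)) j) +
      (1 - ind (w (lk j) = true)) * (1 - ind (T.Hit y j))
  have h1 : T.patternProb lk p y k = expect p fun w => ∏ j ∈ T.branches k, f j w := by
    rw [patternProb]
    congr 1
    funext w
    rw [pattern_iff hk, ind_forall]
    refine Finset.prod_congr rfl fun j _ => ?_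
    simp only [f]
    by_cases hs : w (lk j) = true
    · rw [ind_true hs, one_mul, sub_self, zero_mul, add_zero]
      exact congrArg ind (by simp [hs])
    · rw [ind_false hs, zero_mul, zero_add, sub_zero, one_mul, ← ind_not]
      exact congrArg ind (by simp [hs])
  have hdisj : ∀ j, Disjoint {lk j} (lk '' {i | T.OnPath j i ∧ i ≠ j}) := fun j => by
    rw [Set.disjoint_singleton_left]
    rintro ⟨i, ⟨-, hne⟩, e⟩
    exact hne (hlk e)
  have hpat : ∀ j, DependsOn (fun w : E → Bool => ind (T.Pattern y (fun i => w (lk i)) j))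
      (lk '' {i | T.OnPath j i ∧ i ≠ j}) := fun j w w' h =>
    congrArg ind (dependsOn_pattern lk y j h)
  have hf : ∀ j ∈ T.branches k, DependsOn (f j) (lk '' {i | T.OnPath j i}) := by
    intro j _ w w' h
    have e1 : w (lk j) = w' (lk j) := h _ ⟨j, T.onPath_refl j, rfl⟩
    have e2 := hpat j (x := w) (y := w') fun e he => h e (by
      obtain ⟨i, hi, rfl⟩ := he
      exact ⟨i, hi.1, rfl⟩)
    simp only [f]
    simp only at e2
    rw [e1, e2]
  rw [h1, expect_prod p _ f _ hf]
  · refine Finset.prod_congr rfl fun j _ => ?_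
    simp only [f]
    rw [expect_add, expect_mul p (dependsOn_coord (lk j)) (hpat j) (hdisj j), expect_coord,
      expect_mul_const, expect_sub, expect_one, expect_coord, patternProb]
  · intro j hj j' hj' hne
    rw [Set.disjoint_image_iff hlk]
    exact Set.disjoint_left.2 fun i hi hi' => hne
      ((mem_branches.1 hj).eq_of_onPath (mem_branches.1 hj') hi hi')

theorem reachProb_inner {k : V} (hk : ¬ T.IsLeaf k) :
    1 - T.reachProb lk p k = ∏ j ∈ T.branches k, (1 - p (lk j) * T.reachProb lk p j) := by
  rw [reachProb, sub_sub_cancel, patternProb_inner p hlk hk]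
  refine Finset.prod_congr rfl fun j _ => ?_
  rw [ind_false (not_hit_false j), reachProb]
  ring

theorem reachProb_pos (hp : ∀ e, 0 < p e ∧ p e ≤ 1) (k : V) : 0 < T.reachProb lk p k := by
  induction k using branch_induction (T := T) with
  | h k ih =>
    by_cases hk : T.IsLeaf k
    · rw [reachProb_leaf lk p hk]; exact one_pos
    · have h := prod_one_sub_lt_one (S := T.branches k)
        (x := fun j => p (lk j) * T.reachProb lk p j)
        (fun j hj => mul_pos (hp _).1 (ih j (mem_branches.1 hj)))
        (fun j _ => mul_le_one₀ (hp _).2 (ih j (mem_branches.1 ‹_›)).le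
          (reachProb_le_one lk p (fun e => ⟨(hp e).1.le, (hp e).2⟩) j))
        (let ⟨i, hi, _⟩ := exists_branches hk; ⟨i, hi⟩)
      rw [← reachProb_inner p hlk hk] at h
      linarith

-- A hit node has a link that certainly worked. At an unhit node next to a hit one, either the link
-- failed or nothing was connected beyond it. Links further out are unobserved and contribute 1.
open Classical in
theorem patternProb_of_hit {y : T.Leaf → Bool} {k : V} (h : T.Hit y k) :
    T.patternProb lk p y k = ∏ j ∈ T.beyond k,
      if T.Hit y j then p (lk j)
      else if T.Hit y (T.next j) then 1 - p (lk j) * T.reachProb lk p j else 1 := by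
  induction k using branch_induction (T := T) with
  | h k ih =>
    by_cases hk : T.IsLeaf k
    · rw [patternProb_leaf lk p hk, ind_true h, beyond_leaf hk, Finset.prod_empty]
    · rw [patternProb_inner p hlk hk, prod_beyond]
      refine Finset.prod_congr rfl fun j hj => ?_
      have hj := mem_branches.1 hj
      by_cases hy : T.Hit y j
      · rw [if_pos hy, ind_true hy, ih j hj hy]
        ring
      · rw [if_neg hy, ind_false hy, hj.2, if_pos h, patternProb_of_not_hit lk p hy,
          Finset.prod_eq_one]
        · ring
        -- Beyond the unhit branch j, the node i and its neighbour towards the root, which is still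
        -- j or beyond j, are both unhit.
        · intro i hi
          have hi := mem_beyond.1 hi
          rw [if_neg fun e => hy (hi.1.hit e), if_neg fun e => ?_]
          rcases onPath_iff.1 hi.1 with e' | e'
          · exact hi.2 e'.symm
          · exact hy (e'.hit e)

end Probabilities

end LogicalTree

/-! ### The MINC equation at one node -/

section MincFun

variable {ι : Type*} {S : Finset ι} {x : ι → ℝ}

/-- The quotient (1 - ∏(1 - x_j u))/u does not increase with u. Splitting off one factor, 1 - (1 -
x_a u)P = x_a u + (1 - x_a u)(1 - P): divided by u, the first term is constant, and the second is a
decreasing factor times the quotient for P. -/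
theorem one_sub_prod_mul_le {u v : ℝ} (hu : 0 < u) (huv : u < v) (h0 : ∀ j ∈ S, 0 < x j)
    (h1 : ∀ j ∈ S, x j * v < 1) :
    (1 - ∏ j ∈ S, (1 - x j * v)) * u ≤ (1 - ∏ j ∈ S, (1 - x j * u)) * v := by
  classical
  induction S using Finset.induction_on with
  | empty => simp
  | insert a S ha ih =>
    rw [Finset.prod_insert ha, Finset.prod_insert ha]
    have h0a := h0 a (Finset.mem_insert_self a S)
    have h1a := h1 a (Finset.mem_insert_self a S)
    have h0' : ∀ j ∈ S, 0 < x j := fun j hj => h0 j (Finset.mem_insert_of_mem hj)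
    have h1' : ∀ j ∈ S, x j * v < 1 := fun j hj => h1 j (Finset.mem_insert_of_mem hj)
    have ih := ih h0' h1'
    have hF : ∏ j ∈ S, (1 - x j * u) ≤ 1 := prod_one_sub_le_one
      (fun j hj => (mul_pos (h0' j hj) hu).le)
      fun j hj => (mul_le_mul_of_nonneg_left huv.le (h0' j hj).le).trans (h1' j hj).le
    have e1 := mul_le_mul_of_nonneg_right ih (sub_nonneg.2 h1a.le)
    have e2 : 0 ≤ (1 - ∏ j ∈ S, (1 - x j * u)) * v * (x a * (v - u)) :=
      mul_nonneg (mul_nonneg (sub_nonneg.2 hF) (hu.trans huv).le)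
        (mul_nonneg h0a.le (sub_nonneg.2 huv.le))
    linarith

/-- With a second factor present, the remaining product P is less than 1, so the strict decrease of
1 - x_a u is not lost. This is where two branches at an inner node are needed. -/
theorem one_sub_prod_mul_lt {u v : ℝ} (hu : 0 < u) (huv : u < v) (h0 : ∀ j ∈ S, 0 < x j)
    (h1 : ∀ j ∈ S, x j * v < 1) (hS : ∃ i ∈ S, ∃ j ∈ S, i ≠ j) :
    (1 - ∏ j ∈ S, (1 - x j * v)) * u < (1 - ∏ j ∈ S, (1 - x j * u)) * v := by
  classical
  obtain ⟨a, ha, b, hb, hab⟩ := hS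
  rw [← Finset.mul_prod_erase S _ ha, ← Finset.mul_prod_erase S _ ha]
  have h0' : ∀ j ∈ S.erase a, 0 < x j := fun j hj => h0 j (Finset.mem_of_mem_erase hj)
  have h1' : ∀ j ∈ S.erase a, x j * v < 1 := fun j hj => h1 j (Finset.mem_of_mem_erase hj)
  have hle := one_sub_prod_mul_le hu huv h0' h1'
  have hF : ∏ j ∈ S.erase a, (1 - x j * u) < 1 := prod_one_sub_lt_one
      (fun j hj => mul_pos (h0' j hj) hu)
      (fun j hj => (mul_le_mul_of_nonneg_left huv.le (h0' j hj).le).trans (h1' j hj).le)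
      ⟨b, Finset.mem_erase.2 ⟨hab.symm, hb⟩⟩
  have e1 := mul_le_mul_of_nonneg_right hle (sub_nonneg.2 (h1 a ha).le)
  have e2 : 0 < (1 - ∏ j ∈ S.erase a, (1 - x j * u)) * v * (x a * (v - u)) :=
    mul_pos (mul_pos (sub_pos.2 hF) (hu.trans huv)) (mul_pos (h0 a ha) (sub_pos.2 huv))
  linarith

/-- The value of `γ k` for which `A` solves the equation at `k`, whose branches `S` have
frequencies `x`. -/
noncomputable def mincFun (S : Finset ι) (x : ι → ℝ) (A : ℝ) : ℝ :=
  A * (1 - ∏ j ∈ S, (1 - x j / A))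

theorem mincFun_eq_iff {A c : ℝ} (hA : 0 < A) :
    mincFun S x A = c ↔ 1 - c / A = ∏ j ∈ S, (1 - x j / A) := by
  rw [mincFun]
  constructor
  · intro h
    rw [← h]
    field_simp
    ring
  · intro h
    rw [← h]
    field_simp
    ring

/-- Substitute u = 1/B and v = 1/A. -/
theorem mincFun_lt {A B : ℝ} (hA : 0 < A) (hAB : A < B) (h0 : ∀ j ∈ S, 0 < x j)
    (h1 : ∀ j ∈ S, x j < A) (hS : ∃ i ∈ S, ∃ j ∈ S, i ≠ j) :
    mincFun S x A < mincFun S x B := by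
  have hB := hA.trans hAB
  have h := one_sub_prod_mul_lt (inv_pos.2 hB) ((inv_lt_inv₀ hB hA).2 hAB) h0
    (fun j hj => by rw [← div_eq_mul_inv, div_lt_one hA]; exact h1 j hj) hS
  simp only [← div_eq_mul_inv] at h
  rw [div_lt_div_iff₀ hB hA] at h
  rw [mincFun, mincFun]
  linarith

theorem continuousOn_mincFun : ContinuousOn (mincFun S x) (Set.Ioi 0) := by
  unfold mincFun
  refine continuousOn_id.mul (continuousOn_const.sub (continuousOn_finsetProd _ fun j _ => ?_))
  exact continuousOn_const.sub (continuousOn_const.div continuousOn_id fun A hA => hA.ne')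

theorem exists_mincFun_eq {c : ℝ} (hc : 0 < c) (h0 : ∀ j ∈ S, 0 < x j) (h1 : ∀ j ∈ S, x j < c)
    (hs : c < ∑ j ∈ S, x j) : ∃ A, c < A ∧ mincFun S x A = c := by
  set s := ∑ j ∈ S, x j
  -- Since ∏(1 - x_j/B) ≤ B/(B + s), the value at B is at least Bs/(B + s), which exceeds c iff B(s
  -- - c) > cs; the factor 2 gives room.
  let B := 2 * c * s / (s - c)
  have hsc : 0 < s - c := sub_pos.2 hs
  have hs0 : 0 < s := hc.trans hs
  have hcB : c < B := by
    rw [lt_div_iff₀ hsc]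
    nlinarith
  have hB0 : 0 < B := hc.trans hcB
  have hlow : mincFun S x c < c := by
    have : 0 < ∏ j ∈ S, (1 - x j / c) := Finset.prod_pos fun j hj =>
      sub_pos.2 ((div_lt_one hc).2 (h1 j hj))
    rw [mincFun]
    nlinarith
  have hhigh : c < mincFun S x B := by
    have h := prod_one_sub_mul_one_add_sum_le (S := S) (x := fun j => x j / B)
      (fun j hj => (div_pos (h0 j hj) hB0).le)
      (fun j hj => ((div_lt_one hB0).2 ((h1 j hj).trans hcB)).le)
    rw [← Finset.sum_div] at h
    set P := ∏ j ∈ S, (1 - x j / B)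
    have h' : P * (B + s) ≤ B := by
      have := mul_le_mul_of_nonneg_right h hB0.le
      have e : P * (1 + s / B) * B = P * (B + s) := by field_simp
      rw [one_mul] at this
      exact e ▸ this
    have hBs : B * (s - c) = 2 * c * s := div_mul_cancel₀ _ hsc.ne'
    rw [mincFun]
    have h2 : c * (B + s) < B * (1 - P) * (B + s) := by
      have e : B * (1 - P) * (B + s) = B * (B + s - P * (B + s)) := by ring
      rw [e]
      have : B * s ≤ B * (B + s - P * (B + s)) := mul_le_mul_of_nonneg_left (by linarith) hB0.le
      have := mul_pos hc hs0
      nlinarith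
    exact lt_of_mul_lt_mul_right h2 (by positivity)
  obtain ⟨A, hA, hAc⟩ := intermediate_value_Icc hcB.le
    ((continuousOn_mincFun (S := S) (x := x)).mono fun A hA => hc.trans_le hA.1)
    ⟨hlow.le, hhigh.le⟩
  refine ⟨A, lt_of_le_of_ne hA.1 ?_, hAc⟩
  rintro rfl
  exact hlow.ne hAc

theorem tendsto_mincFun {β : Type*} {l : Filter β} {y : β → ι → ℝ}
    (hy : ∀ j, Tendsto (fun n => y n j) l (nhds (x j))) (A : ℝ) :
    Tendsto (fun n => mincFun S (y n) A) l (nhds (mincFun S x A)) :=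
  tendsto_const_nhds.mul (tendsto_const_nhds.sub (tendsto_finsetProd _ fun j _ =>
    tendsto_const_nhds.sub ((hy j).div_const A)))

end MincFun

/-! ### Existence, uniqueness and continuity of MINC solutions -/

namespace LogicalTree

variable {V : Type*} [Fintype V] {T : LogicalTree V}

/-- The equations of the MINC estimator for arbitrary frequencies `γ`. -/
structure IsMINCFor (T : LogicalTree V) (γ A a : V → ℝ) : Prop where
  leaf : ∀ k, T.IsLeaf k → A k = γ k
  inner_gt : ∀ k, ¬ T.IsLeaf k → γ k < A k
  inner_eq : ∀ k, ¬ T.IsLeaf k → 1 - γ k / A k = ∏ j ∈ T.branches k, (1 - γ j / A k)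
  rate_root : a T.root = A T.root
  rate : ∀ k, k ≠ T.root → a k = A k / A (T.next k)

theorem isMINC_iff {c : (T.Leaf → Bool) → ℕ} {A a : V → ℝ} :
    T.IsMINC c A a ↔ T.IsMINCFor (T.freq c) A a :=
  ⟨fun h => ⟨h.1, h.2, h.3, h.4, h.5⟩, fun h => ⟨h.1, h.2, h.3, h.4, h.5⟩⟩

/-- The inequalities between the frequencies that make the equations uniquely solvable. -/
structure Regular (T : LogicalTree V) (γ : V → ℝ) : Prop where
  pos : ∀ k, 0 < γ k
  lt : ∀ j k, T.IsBranch j k → γ j < γ k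
  sum : ∀ k, ¬ T.IsLeaf k → γ k < ∑ j ∈ T.branches k, γ j

variable {γ A a : V → ℝ}

theorem IsMINCFor.le (h : T.IsMINCFor γ A a) (k : V) : γ k ≤ A k := by
  by_cases hk : T.IsLeaf k
  · exact (h.leaf k hk).ge
  · exact (h.inner_gt k hk).le

theorem IsMINCFor.pos (h : T.IsMINCFor γ A a) (hγ : T.Regular γ) (k : V) : 0 < A k :=
  (hγ.pos k).trans_le (h.le k)

theorem IsMINCFor.mincFun_eq (h : T.IsMINCFor γ A a) (hγ : T.Regular γ) {k : V}
    (hk : ¬ T.IsLeaf k) : mincFun (T.branches k) γ (A k) = γ k :=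
  (mincFun_eq_iff (h.pos hγ k)).2 (h.inner_eq k hk)

theorem Regular.mincFun_lt (hγ : T.Regular γ) {k : V} (hk : ¬ T.IsLeaf k) {B B' : ℝ}
    (hB : γ k < B) (hBB' : B < B') : mincFun (T.branches k) γ B < mincFun (T.branches k) γ B' :=
  _root_.mincFun_lt ((hγ.pos k).trans hB) hBB' (fun j _ => hγ.pos j)
    (fun j hj => (hγ.lt j k (mem_branches.1 hj)).trans hB) (exists_branches hk)

theorem Regular.exists_isMINCFor (hγ : T.Regular γ) : ∃ A a, T.IsMINCFor γ A a := by
  classical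
  have h : ∀ k, ∃ A, (T.IsLeaf k → A = γ k) ∧ (¬ T.IsLeaf k → γ k < A) ∧
      (¬ T.IsLeaf k → 1 - γ k / A = ∏ j ∈ T.branches k, (1 - γ j / A)) := by
    intro k
    by_cases hk : T.IsLeaf k
    · exact ⟨γ k, fun _ => rfl, fun h => absurd hk h, fun h => absurd hk h⟩
    · obtain ⟨A, hA, hAe⟩ := exists_mincFun_eq (hγ.pos k) (fun j _ => hγ.pos j)
        (fun j hj => hγ.lt j k (mem_branches.1 hj)) (hγ.sum k hk)
      exact ⟨A, fun h => absurd h hk, fun _ => hA, fun _ =>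
        (mincFun_eq_iff ((hγ.pos k).trans hA)).1 hAe⟩
  choose A h1 h2 h3 using h
  exact ⟨A, fun k => if k = T.root then A k else A k / A (T.next k), h1, h2, h3, if_pos rfl,
    fun k hk => if_neg hk⟩

theorem IsMINCFor.unique (h : T.IsMINCFor γ A a) (hγ : T.Regular γ) {A' a' : V → ℝ}
    (h' : T.IsMINCFor γ A' a') : A = A' ∧ a = a' := by
  have hA : A = A' := by
    funext k
    by_cases hk : T.IsLeaf k
    · rw [h.leaf k hk, h'.leaf k hk]
    · rcases lt_trichotomy (A k) (A' k) with e | e | e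
      · have := hγ.mincFun_lt hk (h.inner_gt k hk) e
        rw [h.mincFun_eq hγ hk, h'.mincFun_eq hγ hk] at this
        exact absurd this (lt_irrefl _)
      · exact e
      · have := hγ.mincFun_lt hk (h'.inner_gt k hk) e
        rw [h.mincFun_eq hγ hk, h'.mincFun_eq hγ hk] at this
        exact absurd this (lt_irrefl _)
  subst hA
  refine ⟨rfl, funext fun k => ?_⟩
  by_cases hk : k = T.root
  · rw [hk, h.rate_root, h'.rate_root]
  · rw [h.rate k hk, h'.rate k hk]

section Limits

variable {β : Type*} {l : Filter β} {γ' A' a' : β → V → ℝ}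

/-- At a fixed point on either side of the solution, the monotone function differs strictly from
γ_k. This sign persists for nearby frequencies, so it traps their solutions. -/
theorem IsMINCFor.tendsto_path (h : T.IsMINCFor γ A a) (hγ : T.Regular γ)
    (h' : ∀ᶠ n in l, T.Regular (γ' n) ∧ T.IsMINCFor (γ' n) (A' n) (a' n))
    (ht : ∀ k, Tendsto (fun n => γ' n k) l (nhds (γ k))) (k : V) :
    Tendsto (fun n => A' n k) l (nhds (A k)) := by
  by_cases hk : T.IsLeaf k
  · rw [h.leaf k hk]
    refine (ht k).congr' ?_
    filter_upwards [h'] with n hn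
    exact (hn.2.leaf k hk).symm
  · have hgt := h.inner_gt k hk
    refine tendsto_order.2 ⟨fun b hb => ?_, fun b hb => ?_⟩
    -- The given b may lie below γ_k, where monotonicity is not available; hence the comparison
    -- point c between max(b, γ_k) and A_k.
    · obtain ⟨c, hc1, hc2⟩ := exists_between (max_lt hb hgt)
      have hγc : γ k < c := (le_max_right _ _).trans_lt hc1
      have hm := hγ.mincFun_lt hk hγc hc2
      rw [h.mincFun_eq hγ hk] at hm
      filter_upwards [h', (tendsto_mincFun ht c).eventually_lt (ht k) hm] with n hn hlt
      refine (le_max_left _ _).trans_lt (hc1.trans_le (le_of_not_gt fun hcA => ?_))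
      have := hn.1.mincFun_lt hk (hn.2.inner_gt k hk) hcA
      rw [hn.2.mincFun_eq hn.1 hk] at this
      exact lt_asymm this hlt
    · have hγb : γ k < b := hgt.trans hb
      have hm := hγ.mincFun_lt hk hgt hb
      rw [h.mincFun_eq hγ hk] at hm
      filter_upwards [h', (ht k).eventually_lt (tendsto_mincFun ht b) hm,
        (ht k).eventually_lt_const hγb] with n hn hlt hnb
      refine lt_of_not_ge fun hbA => ?_
      rcases hbA.lt_or_eq with hbA | hbA
      · have := hn.1.mincFun_lt hk hnb hbA
        rw [hn.2.mincFun_eq hn.1 hk] at this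
        exact lt_asymm this hlt
      · rw [hbA, hn.2.mincFun_eq hn.1 hk] at hlt
        exact lt_irrefl _ hlt

theorem IsMINCFor.tendsto_rate (h : T.IsMINCFor γ A a) (hγ : T.Regular γ)
    (h' : ∀ᶠ n in l, T.Regular (γ' n) ∧ T.IsMINCFor (γ' n) (A' n) (a' n))
    (ht : ∀ k, Tendsto (fun n => γ' n k) l (nhds (γ k))) (k : V) :
    Tendsto (fun n => a' n k) l (nhds (a k)) := by
  by_cases hk : k = T.root
  · rw [hk, h.rate_root]
    refine (h.tendsto_path hγ h' ht _).congr' ?_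
    filter_upwards [h'] with n hn
    exact hn.2.rate_root.symm
  · rw [h.rate k hk]
    refine ((h.tendsto_path hγ h' ht _).div (h.tendsto_path hγ h' ht _)
      (h.pos hγ _).ne').congr' ?_
    filter_upwards [h'] with n hn
    exact (hn.2.rate k hk).symm

end Limits

end LogicalTree

/-! ### Hit frequencies and the inversion of the MINC equations -/

namespace LogicalTree

variable {V : Type*} [Fintype V] {T : LogicalTree V} {X : Type*} [Fintype X]

/-- The frequencies `γ` when the outcomes `x`, which mark the leaves `m x`, have the weights
`μ x`. -/
noncomputable def hitFreq (m : X → T.Leaf → Bool) (μ : X → ℝ) (k : V) : ℝ :=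
  ∑ x, μ x * ind (T.Hit (m x) k)

open Classical in
theorem freq_eq_hitFreq (m : X → T.Leaf → Bool) (N : X → ℕ) (k : V) :
    T.freq (fun y => ∑ x, if y = m x then N x else 0) k =
      hitFreq m (fun x => (N x : ℝ) / ∑ x, (N x : ℝ)) k := by
  have h : ∀ P : (T.Leaf → Bool) → Prop,
      (∑ y : T.Leaf → Bool, if P y then ((∑ x, if y = m x then N x else 0 : ℕ) : ℝ) else 0) =
        ∑ x, (N x : ℝ) * ind (P (m x)) := by
    intro P
    have e : ∀ y : T.Leaf → Bool,
        (if P y then ((∑ x, if y = m x then N x else 0 : ℕ) : ℝ) else 0) =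
          ∑ x, if y = m x then (N x : ℝ) * ind (P y) else 0 := by
      intro y
      push_cast
      by_cases hP : P y <;> simp [hP, ind]
    simp only [e]
    rw [Finset.sum_comm]
    exact Finset.sum_congr rfl fun x _ => by simp
  have h1 := h fun y => T.Hit y k
  have h2 := h fun _ => True
  simp only [if_true, ind_true trivial, mul_one] at h2
  rw [freq, hitFreq, h2]
  simp only [div_mul_eq_mul_div]
  rw [← Finset.sum_div, ← h1]
  exact congrArg (· / _) (Finset.sum_congr rfl fun y _ => if_congr Iff.rfl rfl rfl)

/-- Each strict inequality has a witness of positive weight. For the sum, a hit at k is a hit at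
some branch at least, and the outcome that hits everything counts at two branches or more. -/
theorem regular_hitFreq {m : X → T.Leaf → Bool} {μ : X → ℝ} (hμ : ∀ x, 0 < μ x)
    (hall : ∃ x, ∀ k, T.Hit (m x) k)
    (hbr : ∀ j k, T.IsBranch j k → ∃ x, T.Hit (m x) k ∧ ¬ T.Hit (m x) j) :
    T.Regular (hitFreq m μ) where
  pos k := by
    obtain ⟨x, hx⟩ := hall
    exact Finset.sum_pos' (fun x _ => mul_nonneg (hμ x).le (ind_nonneg _))
      ⟨x, Finset.mem_univ x, by rw [ind_true (hx k), mul_one]; exact hμ x⟩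
  lt j k hjk := by
    obtain ⟨x, hx, hx'⟩ := hbr j k hjk
    refine Finset.sum_lt_sum
      (fun x _ => mul_le_mul_of_nonneg_left (ind_mono hjk.hit) (hμ x).le) ⟨x, Finset.mem_univ x, ?_⟩
    rw [ind_true hx, ind_false hx', mul_zero, mul_one]
    exact hμ x
  sum k hk := by
    have e : ∑ j ∈ T.branches k, hitFreq m μ j =
        ∑ x, μ x * ∑ j ∈ T.branches k, ind (T.Hit (m x) j) := by
      simp only [hitFreq, Finset.mul_sum]
      exact Finset.sum_comm
    rw [e]
    obtain ⟨x, hx⟩ := hall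
    refine Finset.sum_lt_sum (fun x _ => mul_le_mul_of_nonneg_left ?_ (hμ x).le)
      ⟨x, Finset.mem_univ x, mul_lt_mul_of_pos_left ?_ (hμ x)⟩
    · by_cases h : T.Hit (m x) k
      · obtain ⟨j, hj, hy⟩ := (hit_branches hk _).1 h
        rw [ind_true h, ← ind_true hy]
        exact Finset.single_le_sum (f := fun j => ind (T.Hit (m x) j))
          (fun j _ => ind_nonneg _) hj
      · rw [ind_false h]
        exact Finset.sum_nonneg fun j _ => ind_nonneg _
    · rw [ind_true (hx k)]
      simp only [ind_true (hx _), Finset.sum_const, nsmul_eq_mul, mul_one]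
      exact_mod_cast Finset.one_lt_card.2 (exists_branches hk)

variable {E : Type*} [Fintype E] {lk : V → E} {p : E → ℝ}

/-- The equations hold for the true frequencies. -/
theorem isMINCFor_of_reachProb (hlk : Function.Injective lk) (hp : ∀ e, 0 < p e)
    (hlt : ∀ k, ¬ T.IsLeaf k → T.reachProb lk p k < 1) {κ : ℝ} (hκ : 0 < κ) {γ a : V → ℝ}
    (hγ : ∀ k, γ k = κ * T.pathProb lk p k * T.reachProb lk p k) (hroot : a T.root = κ)
    (ha : ∀ k, k ≠ T.root → a k = p (lk k)) :
    T.IsMINCFor γ (fun k => κ * T.pathProb lk p k) a where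
  leaf k hk := by simp only [hγ, reachProb_leaf lk p hk, mul_one]
  inner_gt k hk := by
    rw [hγ]
    -- Here κ plays the success rate of the aggregate link at the root, so κ times the path
    -- probability is the true value of A.
    exact mul_lt_of_lt_one_right (mul_pos hκ (pathProb_pos p hlk hp k)) (hlt k hk)
  inner_eq k hk := by
    have hπ := (pathProb_pos (T := T) p hlk hp k).ne'
    have hA := mul_ne_zero hκ.ne' hπ
    rw [hγ, mul_div_cancel_left₀ _ hA, reachProb_inner p hlk hk]
    refine Finset.prod_congr rfl fun j hj => ?_
    have hj := mem_branches.1 hj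
    rw [hγ, pathProb_next p hlk hj.1, hj.2]
    field_simp
  rate_root := by rw [hroot, pathProb_root, mul_one]
  rate k hk := by
    have hA := (mul_pos hκ (pathProb_pos (T := T) p hlk hp (T.next k))).ne'
    rw [ha k hk, pathProb_next p hlk hk, mul_left_comm, mul_div_cancel_right₀ _ hA]

/-- Both sides equal 1 at the leaves and obey the same recursion, because a_j γ_j/A_j = γ_j/A_k for
a branch j of k. -/
theorem IsMINCFor.reachProb_eq (hlk : Function.Injective lk) {γ A a : V → ℝ}
    (h : T.IsMINCFor γ A a) (hγ : T.Regular γ) (ha : ∀ k, k ≠ T.root → p (lk k) = a k) (k : V) :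
    T.reachProb lk p k = γ k / A k := by
  induction k using branch_induction (T := T) with
  | h k ih =>
    by_cases hk : T.IsLeaf k
    · rw [reachProb_leaf lk p hk, h.leaf k hk, div_self (hγ.pos k).ne']
    · have e : 1 - T.reachProb lk p k = 1 - γ k / A k := by
        rw [reachProb_inner p hlk hk, h.inner_eq k hk]
        refine Finset.prod_congr rfl fun j hj => ?_
        have hj := mem_branches.1 hj
        have h1 := (h.pos hγ j).ne'
        have h2 := (h.pos hγ k).ne'
        rw [ih j hj, ha j hj.1, h.rate j hj.1, hj.2]
        field_simp
      linarith

/-- The product of the rates A_k/A_{next k} along the path telescopes. -/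
theorem IsMINCFor.pathProb_eq (hlk : Function.Injective lk) {γ A a : V → ℝ}
    (h : T.IsMINCFor γ A a) (hγ : T.Regular γ) (ha : ∀ k, k ≠ T.root → p (lk k) = a k) (k : V) :
    T.pathProb lk p k = A k / A T.root := by
  induction k using root_induction (T := T) with
  | h0 => rw [pathProb_root, div_self (h.pos hγ _).ne']
  | h k hk ih =>
    have h1 := (h.pos hγ (T.next k)).ne'
    have h2 := (h.pos hγ T.root).ne'
    rw [pathProb_next p hlk hk, ih, ha k hk, h.rate k hk]
    field_simp

end LogicalTree

/-! ### Observations in terms of marked sources and receivers -/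

namespace CodedTree

variable {U W : Type*} (G : CodedTree U W)

open Classical in
/-- The link at a node of the upper tree, in the direction of the receivers. -/
noncomputable def upLink (k : U) : G.Link := if h : k = G.C then G.linkCD else G.above ⟨k, h⟩

open Classical in
/-- The link at a node of the lower tree, in the direction of the sources. -/
noncomputable def downLink (k : W) : G.Link := if h : k = G.D then G.linkCD else G.below ⟨k, h⟩

theorem upLink_C : G.upLink G.C = G.linkCD := dif_pos rfl

theorem downLink_D : G.downLink G.D = G.linkCD := dif_pos rfl

theorem upLink_of_ne {k : U} (h : k ≠ G.C) : G.upLink k = G.above ⟨k, h⟩ := dif_neg h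

theorem downLink_of_ne {k : W} (h : k ≠ G.D) : G.downLink k = G.below ⟨k, h⟩ := dif_neg h

theorem upLink_injective : Function.Injective G.upLink := by
  intro j k h
  by_cases hj : j = G.C <;> by_cases hk : k = G.C
  · rw [hj, hk]
  · rw [hj, upLink_C, upLink_of_ne G hk] at h
    cases h
  · rw [hk, upLink_C, upLink_of_ne G hj] at h
    cases h
  · rw [upLink_of_ne G hj, upLink_of_ne G hk] at h
    simpa using h

theorem downLink_injective : Function.Injective G.downLink := by
  intro j k h
  by_cases hj : j = G.D <;> by_cases hk : k = G.D
  · rw [hj, hk]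
  · rw [hj, downLink_D, downLink_of_ne G hk] at h
    cases h
  · rw [hk, downLink_D, downLink_of_ne G hj] at h
    cases h
  · rw [downLink_of_ne G hj, downLink_of_ne G hk] at h
    simpa using h

/-- The links from `l` to `k` in the upper tree work. -/
abbrev UpConn (w : G.Link → Bool) (k l : U) : Prop := G.up.Conn (fun i => w (G.upLink i)) k l

/-- The links from `k` to `l` in the lower tree work. -/
abbrev DownConn (w : G.Link → Bool) (k l : W) : Prop := G.down.Conn (fun i => w (G.downLink i)) k l

variable {G}

theorem arrives_up {w : G.Link → Bool} {u s : U} (h : G.up.OnPath u s) (hc : G.UpConn w u s) :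
    G.Arrives w (Sum.inl s) (Sum.inl u) := by
  induction s using LogicalTree.root_induction (T := G.up) with
  | h0 =>
    rw [h.eq_root]
    exact Relation.ReflTransGen.refl
  | h s hs ih =>
    rcases LogicalTree.onPath_iff.1 h with rfl | h'
    · exact Relation.ReflTransGen.refl
    · have hne : s ≠ u := by
        rintro rfl
        exact LogicalTree.IsBranch.not_onPath ⟨hs, rfl⟩ h'
      have hw : w (G.upLink s) = true := hc s h (G.up.onPath_refl s) hne
      rw [upLink_of_ne G hs] at hw
      exact Relation.ReflTransGen.head ⟨G.above ⟨s, hs⟩, hw, rfl, rfl⟩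
        (ih h' fun i hi his => hc i hi (his.trans (G.up.onPath_next s)))

theorem arrives_down {w : G.Link → Bool} (hw : w G.linkCD = true) {r : W}
    (hc : G.DownConn w G.D r) : G.Arrives w (Sum.inl G.C) (Sum.inr r) := by
  induction r using LogicalTree.root_induction (T := G.down) with
  | h0 => exact Relation.ReflTransGen.single ⟨G.linkCD, hw, rfl, rfl⟩
  | h r hr ih =>
    obtain ⟨h1, h2⟩ := (LogicalTree.conn_root_iff hr _).1 hc
    rw [downLink_of_ne G hr] at h1
    exact (ih h2).tail ⟨G.below ⟨r, hr⟩, h1, rfl, rfl⟩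

/-- The route of a probe is unique: down to C, across `linkCD`, then down from D. The claim is the
invariant along it. -/
theorem Arrives.conn {w : G.Link → Bool} {s : U} {v : U ⊕ W} (h : G.Arrives w (Sum.inl s) v) :
    Sum.elim (fun u => G.up.OnPath u s ∧ G.UpConn w u s)
      (fun r => G.UpConn w G.C s ∧ w G.linkCD = true ∧ G.DownConn w G.D r) v := by
  induction h with
  | refl => exact ⟨G.up.onPath_refl s, LogicalTree.conn_self _ s⟩
  | tail _ h ih =>
    obtain ⟨e, he, rfl, rfl⟩ := h
    rcases e with ⟨k, hk⟩ | _ | ⟨k, hk⟩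
    · have hb : G.up.IsBranch k (G.up.next k) := ⟨hk, rfl⟩
      refine ⟨(G.up.onPath_next k).trans ih.1, (hb.conn_iff ih.1 _).2 ⟨?_, ih.2⟩⟩
      rw [upLink_of_ne G hk]
      exact he
    · exact ⟨ih.2, he, LogicalTree.conn_self _ _⟩
    · refine ⟨ih.1, ih.2.1, (LogicalTree.conn_root_iff hk _).2 ⟨?_, ih.2.2⟩⟩
      rw [downLink_of_ne G hk]
      exact he

open Classical in
theorem observation_eq_true {w : G.Link → Bool} {r : G.Receiver} {s : G.Source} :
    G.observation w r s = true ↔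
      G.UpConn w G.C s ∧ w G.linkCD = true ∧ G.DownConn w G.D r := by
  simp only [observation, decide_eq_true_iff]
  exact ⟨fun h => h.conn, fun h =>
    (arrives_up (G.up.onPath_root _) h.1).trans (arrives_down h.2.1 h.2.2)⟩

open Classical in
/-- The sources whose probes get through to some receiver. -/
noncomputable def sourceMarks (x : G.Outcome) (s : G.Source) : Bool := decide (∃ r, x.1 r s = true)

open Classical in
/-- The receivers that get a nonzero packet. -/
noncomputable def receiverMarks (x : G.Outcome) (r : G.Receiver) : Bool :=
  decide (∃ s, x.1 r s = true)

open Classical in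
theorem sourceMarks_eq_true {x : G.Outcome} {s : G.Source} :
    sourceMarks x s = true ↔ ∃ r, x.1 r s = true := by
  simp only [sourceMarks, decide_eq_true_iff]

open Classical in
theorem receiverMarks_eq_true {x : G.Outcome} {r : G.Receiver} :
    receiverMarks x r = true ↔ ∃ s, x.1 r s = true := by
  simp only [receiverMarks, decide_eq_true_iff]

theorem hit_sourceMarks_C {x : G.Outcome} :
    G.up.Hit (sourceMarks x) G.C ↔ ∃ r s, x.1 r s = true := by
  simp only [LogicalTree.Hit, sourceMarks_eq_true, G.up.onPath_root, true_and]
  exact exists_comm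

theorem hit_receiverMarks_D {x : G.Outcome} :
    G.down.Hit (receiverMarks x) G.D ↔ ∃ r s, x.1 r s = true := by
  simp only [LogicalTree.Hit, receiverMarks_eq_true, G.down.onPath_root, true_and]

/-- The outcome when the links work as `w` tells. -/
noncomputable abbrev outcome (w : G.Link → Bool) : G.Outcome := ⟨G.observation w, w, rfl⟩

theorem not_pattern_up {w : G.Link → Bool} (k : U) :
    ¬ G.up.Pattern (fun _ => false) (fun i => w (G.upLink i)) k ↔
      ∃ s : G.Source, G.up.OnPath k s ∧ G.UpConn w k s := by
  simp only [LogicalTree.Pattern, Bool.false_eq_true, iff_false, not_forall, not_not, exists_prop]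

theorem not_pattern_down {w : G.Link → Bool} (k : W) :
    ¬ G.down.Pattern (fun _ => false) (fun i => w (G.downLink i)) k ↔
      ∃ r : G.Receiver, G.down.OnPath k r ∧ G.DownConn w k r := by
  simp only [LogicalTree.Pattern, Bool.false_eq_true, iff_false, not_forall, not_not, exists_prop]

theorem hit_sourceMarks_iff {w : G.Link → Bool} {k : U} :
    G.up.Hit (sourceMarks (G.outcome w)) k ↔
      (G.UpConn w G.C k ∧ ¬ G.up.Pattern (fun _ => false) (fun i => w (G.upLink i)) k) ∧
        w G.linkCD = true ∧
        ¬ G.down.Pattern (fun _ => false) (fun i => w (G.downLink i)) G.D := by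
  rw [not_pattern_up, not_pattern_down]
  simp only [LogicalTree.Hit, sourceMarks_eq_true, observation_eq_true]
  constructor
  · rintro ⟨s, hs, r, h1, h2, h3⟩
    obtain ⟨h4, h5⟩ := (LogicalTree.conn_trans_iff (G.up.onPath_root k) hs _).1 h1
    exact ⟨⟨h4, s, hs, h5⟩, h2, r, G.down.onPath_root _, h3⟩
  · rintro ⟨⟨h4, s, hs, h5⟩, h2, r, -, h3⟩
    exact ⟨s, hs, r, (LogicalTree.conn_trans_iff (G.up.onPath_root k) hs _).2 ⟨h4, h5⟩, h2, h3⟩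

theorem hit_receiverMarks_iff {w : G.Link → Bool} {k : W} :
    G.down.Hit (receiverMarks (G.outcome w)) k ↔
      ¬ G.up.Pattern (fun _ => false) (fun i => w (G.upLink i)) G.C ∧ w G.linkCD = true ∧
      (G.DownConn w G.D k ∧
        ¬ G.down.Pattern (fun _ => false) (fun i => w (G.downLink i)) k) := by
  rw [not_pattern_up, not_pattern_down]
  simp only [LogicalTree.Hit, receiverMarks_eq_true, observation_eq_true]
  constructor
  · rintro ⟨r, hr, s, h1, h2, h3⟩
    obtain ⟨h4, h5⟩ := (LogicalTree.conn_trans_iff (G.down.onPath_root k) hr _).1 h3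
    exact ⟨⟨s, G.up.onPath_root _, h1⟩, h2, h4, r, hr, h5⟩
  · rintro ⟨⟨s, -, h1⟩, h2, h4, r, hr, h5⟩
    exact ⟨r, hr, s, h1, h2, (LogicalTree.conn_trans_iff (G.down.onPath_root k) hr _).2 ⟨h4, h5⟩⟩

/-- Every probe that arrives uses the link CD, so a nonzero outcome is a full rectangle: s is seen
at r iff s is a marked source and r a marked receiver. -/
theorem observation_eq_iff {x : G.Outcome} (hx : ∃ r s, x.1 r s = true) (w : G.Link → Bool) :
    G.observation w = x.1 ↔
      G.up.Pattern (sourceMarks x) (fun i => w (G.upLink i)) G.C ∧ w G.linkCD = true ∧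
        G.down.Pattern (receiverMarks x) (fun i => w (G.downLink i)) G.D := by
  have e1 : G.up.Pattern (sourceMarks x) (fun i => w (G.upLink i)) G.C ↔
      ∀ s : G.Source, G.UpConn w G.C s ↔ ∃ r, x.1 r s = true := by
    simp only [LogicalTree.Pattern, sourceMarks_eq_true, G.up.onPath_root, true_implies]
  have e2 : G.down.Pattern (receiverMarks x) (fun i => w (G.downLink i)) G.D ↔
      ∀ r : G.Receiver, G.DownConn w G.D r ↔ ∃ s, x.1 r s = true := by
    simp only [LogicalTree.Pattern, receiverMarks_eq_true, G.down.onPath_root, true_implies]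
  rw [e1, e2]
  constructor
  · rintro h
    obtain ⟨r₀, s₀, h₀⟩ := hx
    simp only [← h, observation_eq_true] at h₀ ⊢
    exact ⟨fun s => ⟨fun hs => ⟨r₀, hs, h₀.2⟩, fun ⟨_, hs⟩ => hs.1⟩, h₀.2.1,
      fun r => ⟨fun hr => ⟨s₀, h₀.1, h₀.2.1, hr⟩, fun ⟨_, hr⟩ => hr.2.2⟩⟩
  · rintro ⟨h1, h2, h3⟩
    obtain ⟨y, w₀, rfl⟩ := x
    funext r s
    rw [Bool.eq_iff_iff, observation_eq_true, h1, h3]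
    simp only [observation_eq_true]
    exact ⟨fun ⟨⟨_, a⟩, _, ⟨_, b⟩⟩ => ⟨a.1, b.2⟩, fun a => ⟨⟨r, a⟩, h2, ⟨s, a⟩⟩⟩

theorem observation_eq_iff_of_zero {x : G.Outcome} (hx : ¬ ∃ r s, x.1 r s = true)
    (w : G.Link → Bool) :
    G.observation w = x.1 ↔
      ¬ (¬ G.up.Pattern (fun _ => false) (fun i => w (G.upLink i)) G.C ∧ w G.linkCD = true ∧
        ¬ G.down.Pattern (fun _ => false) (fun i => w (G.downLink i)) G.D) := by
  rw [not_pattern_up, not_pattern_down]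
  simp only [not_exists] at hx
  constructor
  · rintro h ⟨⟨s, -, hs⟩, h2, r, -, hr⟩
    exact hx r s (h ▸ observation_eq_true.2 ⟨hs, h2, hr⟩)
  · intro h
    funext r s
    rw [Bool.eq_iff_iff, observation_eq_true]
    exact iff_of_false (fun ⟨h1, h2, h3⟩ => h ⟨⟨s, G.up.onPath_root _, h1⟩, h2, r,
      G.down.onPath_root _, h3⟩) (hx r s)

theorem exists_outcome_zero : ∃ x : G.Outcome, ¬ ∃ r s, x.1 r s = true := by
  refine ⟨G.outcome fun _ => false, ?_⟩
  rintro ⟨r, s, h⟩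
  exact Bool.false_ne_true (observation_eq_true.1 h).2.1

theorem hit_sourceMarks_of_conn [Finite W] {w : G.Link → Bool} (hD : ∀ i, w (G.downLink i) = true) {k : U}
    {s : G.Source} (hs : G.up.OnPath k s) (hw : ∀ i, G.up.OnPath i s → w (G.upLink i) = true) :
    G.up.Hit (sourceMarks (G.outcome w)) k :=
  hit_sourceMarks_iff.2 ⟨⟨fun i _ hi _ => hw i (hi.trans hs),
    (not_pattern_up k).2 ⟨s, hs, fun i _ hi _ => hw i hi⟩⟩, downLink_D G ▸ hD G.D,
    (not_pattern_down G.D).2 ((G.down.exists_leaf G.D).imp fun _ hr =>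
      ⟨hr, fun i _ _ _ => hD i⟩)⟩

theorem hit_receiverMarks_of_conn [Finite U] {w : G.Link → Bool} (hU : ∀ i, w (G.upLink i) = true) {k : W}
    {r : G.Receiver} (hr : G.down.OnPath k r)
    (hw : ∀ i, G.down.OnPath i r → w (G.downLink i) = true) :
    G.down.Hit (receiverMarks (G.outcome w)) k :=
  hit_receiverMarks_iff.2 ⟨(not_pattern_up G.C).2 ((G.up.exists_leaf G.C).imp fun _ hs =>
      ⟨hs, fun i _ _ _ => hU i⟩), upLink_C G ▸ hU G.C, fun i _ hi _ => hw i (hi.trans hr),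
    (not_pattern_down k).2 ⟨r, hr, fun i _ hi _ => hw i hi⟩⟩

variable [Finite U] [Finite W]

theorem exists_hit_all : ∃ x : G.Outcome,
    (∀ k, G.up.Hit (sourceMarks x) k) ∧ ∀ k, G.down.Hit (receiverMarks x) k := by
  refine ⟨G.outcome fun _ => true, fun k => ?_, fun k => ?_⟩
  · obtain ⟨s, hs⟩ := G.up.exists_leaf k
    exact hit_sourceMarks_of_conn (fun _ => rfl) hs fun _ _ => rfl
  · obtain ⟨r, hr⟩ := G.down.exists_leaf k
    exact hit_receiverMarks_of_conn (fun _ => rfl) hr fun _ _ => rfl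

/-- Let only the link at j fail; a leaf beyond a sibling of j still hits k. -/
theorem exists_hit_branch_up {j k : U} (h : G.up.IsBranch j k) : ∃ x : G.Outcome,
    G.up.Hit (sourceMarks x) k ∧ ¬ G.up.Hit (sourceMarks x) j := by
  classical
  obtain ⟨i, hij, hi⟩ := h.exists_sibling
  obtain ⟨s, hs⟩ := G.up.exists_leaf i
  refine ⟨G.outcome fun e => if e = G.upLink j then false else true, ?_, fun hit => ?_⟩
  · refine hit_sourceMarks_of_conn (fun i' => if_neg fun e => ?_) (hi.onPath.trans hs)
      fun i' hi' => if_neg fun e => ?_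
    · rw [upLink_of_ne G h.1, downLink] at e
      split_ifs at e
    · obtain rfl := G.upLink_injective e
      exact hij (hi.eq_of_onPath h hs hi')
  · have := (hit_sourceMarks_iff.1 hit).1.1 j (G.up.onPath_root j) (G.up.onPath_refl j) h.1
    simp at this

theorem exists_hit_branch_down {j k : W} (h : G.down.IsBranch j k) : ∃ x : G.Outcome,
    G.down.Hit (receiverMarks x) k ∧ ¬ G.down.Hit (receiverMarks x) j := by
  classical
  obtain ⟨i, hij, hi⟩ := h.exists_sibling
  obtain ⟨s, hs⟩ := G.down.exists_leaf i
  refine ⟨G.outcome fun e => if e = G.downLink j then false else true, ?_, fun hit => ?_⟩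
  · refine hit_receiverMarks_of_conn (fun i' => if_neg fun e => ?_) (hi.onPath.trans hs)
      fun i' hi' => if_neg fun e => ?_
    · rw [downLink_of_ne G h.1, upLink] at e
      split_ifs at e; cases e
    · obtain rfl := G.downLink_injective e
      exact hij (hi.eq_of_onPath h hs hi')
  · have := (hit_receiverMarks_iff.1 hit).2.2.1 j (G.down.onPath_root j) (G.down.onPath_refl j) h.1
    simp at this

end CodedTree

/-! ### Outcome probabilities, and matching of the hit frequencies -/

namespace CodedTree

open Classical

variable {U W : Type*} {G : CodedTree U W}

theorem dependsOn_pattern_up (y : G.Source → Bool) (k : U) :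
    DependsOn (fun w : G.Link → Bool => G.up.Pattern y (fun i => w (G.upLink i)) k)
      (G.upLink '' {i | i ≠ G.C}) := fun _ _ h =>
  LogicalTree.dependsOn_pattern G.upLink y k fun e he => h e (by
    obtain ⟨i, ⟨hi, hne⟩, rfl⟩ := he
    refine ⟨i, ?_, rfl⟩
    rintro rfl
    exact hne hi.eq_root.symm)

theorem dependsOn_pattern_down (y : G.Receiver → Bool) (k : W) :
    DependsOn (fun w : G.Link → Bool => G.down.Pattern y (fun i => w (G.downLink i)) k)
      (G.downLink '' {i | i ≠ G.D}) := fun _ _ h =>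
  LogicalTree.dependsOn_pattern G.downLink y k fun e he => h e (by
    obtain ⟨i, ⟨hi, hne⟩, rfl⟩ := he
    refine ⟨i, ?_, rfl⟩
    rintro rfl
    exact hne hi.eq_root.symm)

theorem dependsOn_upConn (k : U) :
    DependsOn (fun w : G.Link → Bool => G.UpConn w G.C k) (G.upLink '' {i | i ≠ G.C}) :=
  fun _ _ h => LogicalTree.dependsOn_conn G.upLink _ k fun e he => h e (by
    obtain ⟨i, ⟨-, -, hne⟩, rfl⟩ := he
    exact ⟨i, hne, rfl⟩)

theorem dependsOn_downConn (k : W) :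
    DependsOn (fun w : G.Link → Bool => G.DownConn w G.D k) (G.downLink '' {i | i ≠ G.D}) :=
  fun _ _ h => LogicalTree.dependsOn_conn G.downLink _ k fun e he => h e (by
    obtain ⟨i, ⟨-, -, hne⟩, rfl⟩ := he
    exact ⟨i, hne, rfl⟩)

variable [Fintype U] [Fintype W]

theorem prob_eq_expect (α : G.Link → ℝ) (x : G.Outcome) :
    G.prob α x = expect α fun w => ind (G.observation w = x.1) := by
  simp only [prob, expect, linkWeight, ind, mul_ite, mul_one, mul_zero]
  exact Finset.sum_congr (by ext; simp) fun _ _ => rfl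

theorem sum_prob_mul (α : G.Link → ℝ) (f : G.Outcome → ℝ) :
    ∑ x, G.prob α x * f x = expect α fun w => f (G.outcome w) := by
  simp only [prob_eq_expect, expect, Finset.sum_mul]
  rw [Finset.sum_comm]
  refine Finset.sum_congr rfl fun w _ => ?_
  rw [Finset.sum_eq_single (G.outcome w)]
  · rw [ind_true rfl, mul_one]
  · intro x _ hx
    rw [ind_false fun h => hx (Subtype.ext h.symm), mul_zero, zero_mul]
  · exact fun h => absurd (Finset.mem_univ _) h

theorem sum_prob (α : G.Link → ℝ) : ∑ x, G.prob α x = 1 := by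
  have := sum_prob_mul α fun _ => 1
  simpa only [mul_one, expect_one] using this

/-- `upLink` and `downLink` both send the root to `linkCD`; leaving the roots out, the upper links,
`linkCD` and the lower links are disjoint. -/
theorem expect_and_and (α : G.Link → ℝ) {P Q : (G.Link → Bool) → Prop}
    (hP : DependsOn P (G.upLink '' {i | i ≠ G.C})) (hQ : DependsOn Q (G.downLink '' {i | i ≠ G.D})) :
    (expect α fun w => ind (P w ∧ w G.linkCD = true ∧ Q w)) =
      expect α (fun w => ind (P w)) * (α G.linkCD * expect α fun w => ind (Q w)) := by
  have hP' : DependsOn (fun w => ind (P w)) (G.upLink '' {i | i ≠ G.C}) :=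
    fun w w' h => congrArg ind (hP h)
  have hQ' : DependsOn (fun w => ind (Q w)) (G.downLink '' {i | i ≠ G.D}) :=
    fun w w' h => congrArg ind (hQ h)
  have hd : Disjoint {G.linkCD} (G.downLink '' {i | i ≠ G.D}) := by
    rw [Set.disjoint_singleton_left]
    rintro ⟨i, hi, e⟩
    rw [downLink_of_ne G hi] at e
    cases e
  have hd' : Disjoint (G.upLink '' {i | i ≠ G.C}) ({G.linkCD} ∪ G.downLink '' {i | i ≠ G.D}) := by
    rw [Set.disjoint_left]
    rintro _ ⟨i, hi, rfl⟩ (e | ⟨j, hj, e⟩)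
    · rw [upLink_of_ne G hi] at e
      cases e
    · rw [upLink_of_ne G hi, downLink_of_ne G hj] at e
      cases e
  simp only [ind_and]
  rw [expect_mul α hP' ((dependsOn_coord G.linkCD).comp₂ hQ' (· * ·)) hd',
    expect_mul α (dependsOn_coord G.linkCD) hQ' hd, expect_coord]

variable (G) in
/-- The probability that some probe reaches `k` from above. -/
noncomputable abbrev upReach (α : G.Link → ℝ) (k : U) : ℝ := G.up.reachProb G.upLink α k

variable (G) in
/-- The probability that a packet at `k` reaches some receiver. -/
noncomputable abbrev downReach (α : G.Link → ℝ) (k : W) : ℝ := G.down.reachProb G.downLink α k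

theorem prob_of_ne_zero (α : G.Link → ℝ) {x : G.Outcome} (hx : ∃ r s, x.1 r s = true) :
    G.prob α x = G.up.patternProb G.upLink α (sourceMarks x) G.C *
      (α G.linkCD * G.down.patternProb G.downLink α (receiverMarks x) G.D) := by
  simp only [prob_eq_expect, observation_eq_iff hx]
  rw [expect_and_and α (dependsOn_pattern_up _ _) (dependsOn_pattern_down _ _)]
  rfl

theorem prob_of_zero (α : G.Link → ℝ) {x : G.Outcome} (hx : ¬ ∃ r s, x.1 r s = true) :
    G.prob α x = 1 - G.upReach α G.C * (α G.linkCD * G.downReach α G.D) := by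
  simp only [prob_eq_expect, observation_eq_iff_of_zero hx]
  simp only [ind_not (_ ∧ _)]
  rw [expect_sub, expect_one, expect_and_and α
    (fun _ _ h => congrArg Not (dependsOn_pattern_up _ _ h))
    (fun _ _ h => congrArg Not (dependsOn_pattern_down _ _ h)),
    LogicalTree.expect_reach, LogicalTree.expect_reach]

theorem hitFreq_up_prob (α : G.Link → ℝ) (k : U) :
    LogicalTree.hitFreq (T := G.up) sourceMarks (G.prob α) k =
      α G.linkCD * G.downReach α G.D * G.up.pathProb G.upLink α k * G.upReach α k := by
  rw [LogicalTree.hitFreq, sum_prob_mul α fun x => ind (G.up.Hit (sourceMarks x) k)]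
  simp only [hit_sourceMarks_iff]
  rw [expect_and_and α
    (fun w w' h => by
      have h1 := dependsOn_upConn k h
      have h2 := dependsOn_pattern_up (fun _ => false) k h
      simp only at h1 h2 ⊢
      rw [h1, h2])
    (fun _ _ h => congrArg Not (dependsOn_pattern_down _ _ h)), LogicalTree.expect_reach,
    LogicalTree.expect_path_reach α G.upLink_injective]
  ring

theorem hitFreq_down_prob (α : G.Link → ℝ) (k : W) :
    LogicalTree.hitFreq (T := G.down) receiverMarks (G.prob α) k =
      G.upReach α G.C * α G.linkCD * G.down.pathProb G.downLink α k * G.downReach α k := by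
  rw [LogicalTree.hitFreq, sum_prob_mul α fun x => ind (G.down.Hit (receiverMarks x) k)]
  simp only [hit_receiverMarks_iff]
  rw [expect_and_and α
    (fun _ _ h => congrArg Not (dependsOn_pattern_up _ _ h))
    (fun w w' h => by
      have h1 := dependsOn_downConn k h
      have h2 := dependsOn_pattern_down (fun _ => false) k h
      simp only at h1 h2 ⊢
      rw [h1, h2]), LogicalTree.expect_reach,
    LogicalTree.expect_path_reach α G.downLink_injective]
  ring

/-- The equations of the algorithm for arbitrary frequencies. -/
def IsOutputFor (G : CodedTree U W) (γm : W → ℝ) (γr : U → ℝ) (α : G.Link → ℝ) : Prop :=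
  ∃ (Am am : W → ℝ) (Ar ar : U → ℝ),
    G.down.IsMINCFor γm Am am ∧ G.up.IsMINCFor γr Ar ar ∧
    (∀ k, α (G.below k) = am k.1) ∧ (∀ k, α (G.above k) = ar k.1) ∧
    α G.linkCD = Ar G.C * Am G.D / γm G.D

section Output

variable {γm : W → ℝ} {γr : U → ℝ}

theorem existsUnique_output (hm : G.down.Regular γm) (hr : G.up.Regular γr) :
    ∃! α, G.IsOutputFor γm γr α := by
  obtain ⟨Am, am, h1⟩ := hm.exists_isMINCFor
  obtain ⟨Ar, ar, h2⟩ := hr.exists_isMINCFor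
  refine ⟨Sum.elim (fun k => ar k.1) (Sum.elim (fun _ => Ar G.C * Am G.D / γm G.D)
    fun k => am k.1), ⟨Am, am, Ar, ar, h1, h2, fun _ => rfl, fun _ => rfl, rfl⟩, ?_⟩
  rintro β ⟨Bm, bm, Br, br, h3, h4, e1, e2, e3⟩
  obtain ⟨rfl, rfl⟩ := h1.unique hm h3
  obtain ⟨rfl, rfl⟩ := h2.unique hr h4
  funext e
  rcases e with k | _ | k
  · exact e2 k
  · exact e3
  · exact e1 k

/-- For the lower tree, the probability of a hit at k is (γr_C/Ar_C) · α_CD · (Am_k/Am_D) ·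
(γm_k/Am_k). The formula for α_CD is the one that cancels this to γm_k, given γm_D = γr_C; the upper
tree is symmetric. -/
theorem IsOutputFor.hitFreq_eq {α : G.Link → ℝ} (h : G.IsOutputFor γm γr α)
    (hm : G.down.Regular γm) (hr : G.up.Regular γr) (hCD : γm G.D = γr G.C) :
    LogicalTree.hitFreq (T := G.down) receiverMarks (G.prob α) = γm ∧
      LogicalTree.hitFreq (T := G.up) sourceMarks (G.prob α) = γr := by
  obtain ⟨Am, am, Ar, ar, h1, h2, e1, e2, e3⟩ := h
  have hm' : ∀ k, k ≠ G.down.root → α (G.downLink k) = am k := fun k hk => by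
    rw [downLink_of_ne G hk, e1]
  have hr' : ∀ k, k ≠ G.up.root → α (G.upLink k) = ar k := fun k hk => by
    rw [upLink_of_ne G hk, e2]
  have a1 : ∀ k, G.downReach α k = γm k / Am k :=
    h1.reachProb_eq (p := α) G.downLink_injective hm hm'
  have a2 := h1.pathProb_eq (p := α) G.downLink_injective hm hm'
  have a3 : ∀ k, G.upReach α k = γr k / Ar k :=
    h2.reachProb_eq (p := α) G.upLink_injective hr hr'
  have a4 := h2.pathProb_eq (p := α) G.upLink_injective hr hr'
  have p1 := (h1.pos hm G.D).ne'
  have p2 := (h2.pos hr G.C).ne'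
  have p3 := (hr.pos G.C).ne'
  constructor
  · funext k
    have := (h1.pos hm k).ne'
    rw [hitFreq_down_prob, a1, a2, a3, e3, hCD]
    field_simp
  · funext k
    have := (h2.pos hr k).ne'
    rw [hitFreq_up_prob, a1, a3, a4, e3, hCD]
    field_simp

end Output

theorem prob_nonneg {α : G.Link → ℝ} (hα : α ∈ G.rates) (x : G.Outcome) : 0 ≤ G.prob α x := by
  rw [prob_eq_expect]
  exact expect_nonneg α (fun e => ⟨(hα e).1.le, (hα e).2⟩) fun _ => ind_nonneg _

theorem prob_pos_of_lt_one {α : G.Link → ℝ} (hα : ∀ e, 0 < α e ∧ α e < 1) (x : G.Outcome) :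
    0 < G.prob α x := by
  obtain ⟨w, hw⟩ := x.2
  have hpos : ∀ w, 0 < linkWeight α w := fun w => Finset.prod_pos fun e _ => by
    split_ifs
    · exact (hα e).1
    · exact sub_pos.2 (hα e).2
  rw [prob_eq_expect]
  refine Finset.sum_pos' (fun w _ => mul_nonneg (hpos w).le (ind_nonneg _))
    ⟨w, by simp, ?_⟩
  change 0 < linkWeight α w * ind (G.observation w = x.1)
  rw [ind_true hw, mul_one]
  exact hpos w

end CodedTree

/-! ### Logarithms and positivity of pattern probabilities -/

namespace LogicalTree

variable {V : Type*} [Fintype V] {T : LogicalTree V}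

/-- A hit at k forces a hit at the next node towards the root, so the difference of the indicators
marks precisely the unhit nodes next to a hit one. -/
theorem log_patternProb {E : Type*} [Fintype E] {lk : V → E} (hlk : Function.Injective lk)
    (p : E → ℝ) {y : T.Leaf → Bool} (h : T.Hit y T.root)
    (h0 : T.patternProb lk p y T.root ≠ 0) :
    Real.log (T.patternProb lk p y T.root) = ∑ k ∈ T.beyond T.root,
      (ind (T.Hit y k) * Real.log (p (lk k)) + (ind (T.Hit y (T.next k)) - ind (T.Hit y k)) *
        Real.log (1 - p (lk k) * T.reachProb lk p k)) := by
  rw [patternProb_of_hit p hlk h] at h0 ⊢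
  rw [Real.log_prod (Finset.prod_ne_zero_iff.1 h0)]
  refine Finset.sum_congr rfl fun k _ => ?_
  by_cases h1 : T.Hit y k
  · have h2 : T.Hit y (T.next k) := (T.onPath_next k).hit h1
    simp [h1, h2, ind]
  · by_cases h2 : T.Hit y (T.next k) <;> simp [h1, h2, ind]

omit [Fintype V] in
theorem sum_mul_sum_hit {X : Type*} [Fintype X] (m : X → T.Leaf → Bool) (μ : X → ℝ)
    (S : Finset V) (a b : V → ℝ) :
    ∑ x, μ x * ∑ k ∈ S, (ind (T.Hit (m x) k) * a k +
        (ind (T.Hit (m x) (T.next k)) - ind (T.Hit (m x) k)) * b k) =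
      ∑ k ∈ S, (hitFreq m μ k * a k + (hitFreq m μ (T.next k) - hitFreq m μ k) * b k) := by
  simp only [Finset.mul_sum]
  rw [Finset.sum_comm]
  refine Finset.sum_congr rfl fun k _ => ?_
  simp only [hitFreq, ← Finset.sum_sub_distrib, Finset.sum_mul, ← Finset.sum_add_distrib]
  exact Finset.sum_congr rfl fun x _ => by ring

theorem patternProb_pos {E : Type*} [Fintype E] {lk : V → E}
    (hlk : Function.Injective lk) {p : E → ℝ} (hp : ∀ e, 0 < p e)
    (hlt : ∀ k, k ≠ T.root → p (lk k) * T.reachProb lk p k < 1) {y : T.Leaf → Bool}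
    (h : T.Hit y T.root) : 0 < T.patternProb lk p y T.root := by
  rw [patternProb_of_hit p hlk h]
  refine Finset.prod_pos fun k hk => ?_
  split_ifs
  · exact hp _
  · exact sub_pos.2 (hlt k (mem_beyond.1 hk).2)
  · exact one_pos

/-- The product is γ_k/A_{next k}, which is below 1 even where the rate itself equals 1. -/
theorem IsMINCFor.mul_reachProb_lt {E : Type*} [Fintype E] {lk : V → E} (hlk : Function.Injective lk) {p : E → ℝ} {γ A a : V → ℝ}
    (h : T.IsMINCFor γ A a) (hγ : T.Regular γ) (ha : ∀ k, k ≠ T.root → p (lk k) = a k) (k : V)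
    (hk : k ≠ T.root) : p (lk k) * T.reachProb lk p k < 1 := by
  rw [h.reachProb_eq hlk hγ ha, ha k hk, h.rate k hk]
  have h1 := (h.pos hγ k).ne'
  have h2 := h.pos hγ (T.next k)
  have e : A k / A (T.next k) * (γ k / A k) = γ k / A (T.next k) := by field_simp
  rw [e, div_lt_one h2]
  exact (hγ.lt k (T.next k) ⟨hk, rfl⟩).trans_le (h.le _)

/-- If k always reached a leaf, some branch j would be certain to have a leaf connected to k, and
every pattern that hits k but not j would have probability zero. -/
theorem reachProb_lt_one {E : Type*} [Fintype E] {lk : V → E}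
    (hlk : Function.Injective lk) {p : E → ℝ} (hp : ∀ e, 0 < p e ∧ p e ≤ 1)
    (h : ∀ j k, T.IsBranch j k → ∃ y, T.Hit y k ∧ ¬ T.Hit y j ∧ T.patternProb lk p y T.root ≠ 0)
    {k : V} (hk : ¬ T.IsLeaf k) : T.reachProb lk p k < 1 := by
  have hle := reachProb_le_one (T := T) lk p (fun e => ⟨(hp e).1.le, (hp e).2⟩) k
  refine lt_of_le_of_ne hle fun e => ?_
  have hi := reachProb_inner p hlk hk
  rw [e, sub_self] at hi
  obtain ⟨j, hj, hj0⟩ := Finset.prod_eq_zero_iff.1 hi.symm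
  have hj := mem_branches.1 hj
  obtain ⟨y, hy, hyj, h0⟩ := h j k hj
  refine h0 ?_
  rw [patternProb_of_hit p hlk ((T.onPath_root k).hit hy)]
  refine Finset.prod_eq_zero (mem_beyond.2 ⟨T.onPath_root j, hj.1⟩) ?_
  rw [if_neg hyj, hj.2, if_pos hy, hj0]

end LogicalTree

/-! ### Likelihood: sufficiency of the frequencies, Gibbs' inequality, maximality -/

namespace CodedTree

open Classical

variable {U W : Type*} {G : CodedTree U W} [Fintype U] [Fintype W]

variable (G) in
/-- The frequencies of the reduced multicast tree for outcome weights `μ`. -/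
noncomputable abbrev downFreq (μ : G.Outcome → ℝ) : W → ℝ :=
  LogicalTree.hitFreq (T := G.down) receiverMarks μ

variable (G) in
/-- The frequencies of the reduced reverse multicast tree for outcome weights `μ`. -/
noncomputable abbrev upFreq (μ : G.Outcome → ℝ) : U → ℝ :=
  LogicalTree.hitFreq (T := G.up) sourceMarks μ

omit [Fintype U] [Fintype W] in
theorem ind_hit_eq (x : G.Outcome) :
    ind (G.down.Hit (receiverMarks x) G.D) = ind (G.up.Hit (sourceMarks x) G.C) :=
  congrArg ind (propext (hit_receiverMarks_D.trans hit_sourceMarks_C.symm))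

theorem downFreq_D (μ : G.Outcome → ℝ) : G.downFreq μ G.D = G.upFreq μ G.C := by
  simp only [LogicalTree.hitFreq, ind_hit_eq]

theorem downFreq_D_lt {μ : G.Outcome → ℝ} (hμ : ∀ x, 0 < μ x) : G.downFreq μ G.D < ∑ x, μ x := by
  obtain ⟨x, hx⟩ := exists_outcome_zero (G := G)
  refine Finset.sum_lt_sum (fun x _ => ?_) ⟨x, Finset.mem_univ x, ?_⟩
  · exact mul_le_of_le_one_right (hμ x).le (by rw [← ind_true trivial]; exact ind_mono fun _ => trivial)
  · rw [ind_false fun h => hx (hit_receiverMarks_D.1 h), mul_zero]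
    exact hμ x

theorem regular_downFreq {μ : G.Outcome → ℝ} (hμ : ∀ x, 0 < μ x) :
    G.down.Regular (G.downFreq μ) :=
  LogicalTree.regular_hitFreq hμ (exists_hit_all.imp fun _ h => h.2)
    fun _ _ h => exists_hit_branch_down h

theorem regular_upFreq {μ : G.Outcome → ℝ} (hμ : ∀ x, 0 < μ x) : G.up.Regular (G.upFreq μ) :=
  LogicalTree.regular_hitFreq hμ (exists_hit_all.imp fun _ h => h.1)
    fun _ _ h => exists_hit_branch_up h

theorem downFreq_prob_D (α : G.Link → ℝ) :
    G.downFreq (G.prob α) G.D = G.upReach α G.C * (α G.linkCD * G.downReach α G.D) := by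
  rw [downFreq, hitFreq_down_prob, LogicalTree.pathProb_root, mul_one, mul_assoc]

/-- The estimated distribution gives all outcomes positive probability. -/
theorem IsOutputFor.prob_pos {μ : G.Outcome → ℝ} (hμ : ∀ x, 0 < μ x) (hsum : ∑ x, μ x = 1)
    {α : G.Link → ℝ} (h : G.IsOutputFor (G.downFreq μ) (G.upFreq μ) α) (hα : α ∈ G.rates)
    (x : G.Outcome) : 0 < G.prob α x := by
  have hq := (h.hitFreq_eq (regular_downFreq hμ) (regular_upFreq hμ) (downFreq_D μ)).1
  obtain ⟨Am, am, Ar, ar, h1, h2, e1, e2, -⟩ := h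
  by_cases hx : ∃ r s, x.1 r s = true
  · rw [prob_of_ne_zero α hx]
    -- Rates equal to 1 are allowed, so positivity has to come from `mul_reachProb_lt`.
    refine mul_pos (LogicalTree.patternProb_pos G.upLink_injective (fun e => (hα e).1)
      (h2.mul_reachProb_lt G.upLink_injective (regular_upFreq hμ) fun k hk => ?_)
      (hit_sourceMarks_C.2 hx)) (mul_pos (hα _).1 (LogicalTree.patternProb_pos G.downLink_injective
      (fun e => (hα e).1) (h1.mul_reachProb_lt G.downLink_injective (regular_downFreq hμ) fun k hk => ?_) (hit_receiverMarks_D.2 hx)))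
    · rw [upLink_of_ne G hk, e2]
    · rw [downLink_of_ne G hk, e1]
  · rw [prob_of_zero α hx, ← downFreq_prob_D, sub_pos]
    change LogicalTree.hitFreq _ _ _ < _
    rw [hq, ← hsum]
    exact downFreq_D_lt hμ

/-- Rates for which all outcomes are possible are recovered from the outcome distribution. -/
theorem isOutputFor_prob {α : G.Link → ℝ} (hα : α ∈ G.rates) (hpos : ∀ x, 0 < G.prob α x) :
    G.IsOutputFor (G.downFreq (G.prob α)) (G.upFreq (G.prob α)) α := by
  have hU : 0 < G.upReach α G.C := LogicalTree.reachProb_pos α G.upLink_injective hα _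
  have hD : 0 < G.downReach α G.D := LogicalTree.reachProb_pos α G.downLink_injective hα _
  have hCD := (hα G.linkCD).1
  have hα0 : ∀ e, 0 < α e := fun e => (hα e).1
  -- The aggregate link into D works iff some probe reaches C and the link CD works; symmetrically
  -- for the one out of C.
  refine ⟨_, fun k => if k = G.D then G.upReach α G.C * α G.linkCD else α (G.downLink k), _,
    fun k => if k = G.C then α G.linkCD * G.downReach α G.D else α (G.upLink k),
    LogicalTree.isMINCFor_of_reachProb G.downLink_injective hα0
      (fun k hk => LogicalTree.reachProb_lt_one G.downLink_injective hα (fun j k hjk => ?_) hk)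
      (mul_pos hU hCD) (hitFreq_down_prob α) (if_pos rfl) (fun k hk => if_neg hk),
    LogicalTree.isMINCFor_of_reachProb G.upLink_injective hα0
      (fun k hk => LogicalTree.reachProb_lt_one G.upLink_injective hα (fun j k hjk => ?_) hk)
      (mul_pos hCD hD) (hitFreq_up_prob α) (if_pos rfl) (fun k hk => if_neg hk),
    fun k => ?_, fun k => ?_, ?_⟩
  · obtain ⟨x, hx, hx'⟩ := exists_hit_branch_down hjk
    refine ⟨_, hx, hx', fun h0 => (hpos x).ne' ?_⟩
    rw [prob_of_ne_zero α (hit_receiverMarks_D.1 ((G.down.onPath_root k).hit hx)), h0, mul_zero,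
      mul_zero]
  · obtain ⟨x, hx, hx'⟩ := exists_hit_branch_up hjk
    refine ⟨_, hx, hx', fun h0 => (hpos x).ne' ?_⟩
    rw [prob_of_ne_zero α (hit_sourceMarks_C.1 ((G.up.onPath_root k).hit hx)), h0, zero_mul]
  · simp only [if_neg k.2, downLink_of_ne G k.2]
  · simp only [if_neg k.2, upLink_of_ne G k.2]
  · rw [downFreq_prob_D, LogicalTree.pathProb_root, LogicalTree.pathProb_root]
    field_simp

/-- For the zero outcome all indicators vanish and only the logarithm of its own probability
remains; otherwise the tree factors supply the sums. -/
theorem log_prob {α : G.Link → ℝ} {x : G.Outcome} (hpos : 0 < G.prob α x) :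
    Real.log (G.prob α x) =
      ind (G.up.Hit (sourceMarks x) G.C) * Real.log (α G.linkCD) +
      (1 - ind (G.up.Hit (sourceMarks x) G.C)) *
        Real.log (1 - G.upReach α G.C * (α G.linkCD * G.downReach α G.D)) +
      (∑ k ∈ G.up.beyond G.C, (ind (G.up.Hit (sourceMarks x) k) * Real.log (α (G.upLink k)) +
        (ind (G.up.Hit (sourceMarks x) (G.up.next k)) - ind (G.up.Hit (sourceMarks x) k)) *
        Real.log (1 - α (G.upLink k) * G.upReach α k))) +
      ∑ k ∈ G.down.beyond G.D, (ind (G.down.Hit (receiverMarks x) k) *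
          Real.log (α (G.downLink k)) +
        (ind (G.down.Hit (receiverMarks x) (G.down.next k)) -
          ind (G.down.Hit (receiverMarks x) k)) *
        Real.log (1 - α (G.downLink k) * G.downReach α k)) := by
  by_cases hx : ∃ r s, x.1 r s = true
  · have hC := hit_sourceMarks_C.2 hx
    have hD := hit_receiverMarks_D.2 hx
    have hp := prob_of_ne_zero α hx
    rw [hp] at hpos ⊢
    have h1 := left_ne_zero_of_mul hpos.ne'
    have h2 := right_ne_zero_of_mul hpos.ne'
    rw [Real.log_mul h1 h2, Real.log_mul (left_ne_zero_of_mul h2) (right_ne_zero_of_mul h2),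
      LogicalTree.log_patternProb G.upLink_injective α hC h1,
      LogicalTree.log_patternProb G.downLink_injective α hD (right_ne_zero_of_mul h2),
      ind_true hC]
    ring
  · have hC : ∀ k, ¬ G.up.Hit (sourceMarks x) k := fun k h =>
      hx (hit_sourceMarks_C.1 ((G.up.onPath_root k).hit h))
    have hD : ∀ k, ¬ G.down.Hit (receiverMarks x) k := fun k h =>
      hx (hit_receiverMarks_D.1 ((G.down.onPath_root k).hit h))
    rw [prob_of_zero α hx]
    simp only [ind_false (hC _), ind_false (hD _)]
    simp

/-- The expected log-likelihood depends on the weights through the frequencies only. -/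
theorem sum_mul_log_prob {α : G.Link → ℝ} (hpos : ∀ x, 0 < G.prob α x) {μ ν : G.Outcome → ℝ}
    (hs : ∑ x, μ x = ∑ x, ν x) (hd : G.downFreq μ = G.downFreq ν) (hu : G.upFreq μ = G.upFreq ν) :
    ∑ x, μ x * Real.log (G.prob α x) = ∑ x, ν x * Real.log (G.prob α x) := by
  have key : ∀ μ : G.Outcome → ℝ, ∑ x, μ x * Real.log (G.prob α x) =
      G.upFreq μ G.C * Real.log (α G.linkCD) + ((∑ x, μ x) - G.upFreq μ G.C) *
        Real.log (1 - G.upReach α G.C * (α G.linkCD * G.downReach α G.D)) +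
      (∑ k ∈ G.up.beyond G.C, (G.upFreq μ k * Real.log (α (G.upLink k)) +
        (G.upFreq μ (G.up.next k) - G.upFreq μ k) *
          Real.log (1 - α (G.upLink k) * G.upReach α k))) +
      ∑ k ∈ G.down.beyond G.D, (G.downFreq μ k * Real.log (α (G.downLink k)) +
        (G.downFreq μ (G.down.next k) - G.downFreq μ k) *
          Real.log (1 - α (G.downLink k) * G.downReach α k)) := by
    intro μ
    rw [← LogicalTree.sum_mul_sum_hit, ← LogicalTree.sum_mul_sum_hit]
    simp only [LogicalTree.hitFreq, ← Finset.sum_sub_distrib, Finset.sum_mul,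
      ← Finset.sum_add_distrib]
    refine Finset.sum_congr rfl fun x _ => ?_
    rw [log_prob (hpos x)]
    ring
  rw [key μ, key ν, hs, hd, hu]

theorem likelihood_nonneg {α : G.Link → ℝ} (hα : α ∈ G.rates) (N : G.Outcome → ℕ) :
    0 ≤ G.likelihood N α := Finset.prod_nonneg fun x _ => pow_nonneg (prob_nonneg hα x) _

theorem likelihood_eq_exp {α : G.Link → ℝ} (hpos : ∀ x, 0 < G.prob α x) (N : G.Outcome → ℕ) :
    G.likelihood N α = Real.exp (∑ x, (N x : ℝ) * Real.log (G.prob α x)) := by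
  rw [Real.exp_sum]
  refine Finset.prod_congr rfl fun x _ => ?_
  rw [mul_comm, Real.exp_mul, Real.exp_log (hpos x), Real.rpow_natCast]

/-- Gibbs' inequality, with its case of equality. -/
theorem sum_mul_log_le {X : Type*} [Fintype X] {p q : X → ℝ} (hp : ∀ x, 0 < p x)
    (hq : ∀ x, 0 < q x) (hs : ∑ x, p x = ∑ x, q x) :
    ∑ x, p x * Real.log (q x) ≤ ∑ x, p x * Real.log (p x) ∧
      (∑ x, p x * Real.log (p x) ≤ ∑ x, p x * Real.log (q x) → q = p) := by
  -- Apply log t ≤ t - 1 with t = q/p; the terms q - p sum to zero, and equality forces t = 1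
  -- termwise.
  have hle : ∀ x, p x * Real.log (q x) ≤ p x * Real.log (p x) + (q x - p x) := fun x => by
    have h := Real.log_le_sub_one_of_pos (div_pos (hq x) (hp x))
    rw [Real.log_div (hq x).ne' (hp x).ne'] at h
    have h' := mul_le_mul_of_nonneg_left h (hp x).le
    have e : p x * (q x / p x - 1) = q x - p x := by
      have := (hp x).ne'
      field_simp
    rw [e] at h'
    linarith
  have htot : ∑ x, (p x * Real.log (p x) + (q x - p x)) = ∑ x, p x * Real.log (p x) := by
    rw [Finset.sum_add_distrib, Finset.sum_sub_distrib, hs]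
    ring
  refine ⟨(Finset.sum_le_sum fun x _ => hle x).trans htot.le, fun h => ?_⟩
  have heq := (Finset.sum_eq_sum_iff_of_le fun x (_ : x ∈ Finset.univ) => hle x).1
    (le_antisymm (Finset.sum_le_sum fun x _ => hle x) (htot.le.trans h))
  funext x
  have hx := heq x (Finset.mem_univ x)
  by_contra hne
  have h := Real.log_lt_sub_one_of_pos (div_pos (hq x) (hp x)) fun e =>
    hne ((div_eq_one_iff_eq (hp x).ne').1 e)
  rw [Real.log_div (hq x).ne' (hp x).ne'] at h
  have h' := mul_lt_mul_of_pos_left h (hp x)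
  have e : p x * (q x / p x - 1) = q x - p x := by
    have := (hp x).ne'
    field_simp
  rw [e] at h'
  linarith

variable {N : G.Outcome → ℕ}

/-- The empirical distribution. -/
noncomputable def empirical (N : G.Outcome → ℕ) (x : G.Outcome) : ℝ := N x / ∑ x, (N x : ℝ)

theorem sum_counts_pos (hN : ∀ x, 0 < N x) : 0 < ∑ x, (N x : ℝ) := by
  obtain ⟨x, -⟩ := exists_outcome_zero (G := G)
  exact Finset.sum_pos (fun x _ => Nat.cast_pos.2 (hN x)) ⟨x, Finset.mem_univ x⟩

theorem empirical_pos (hN : ∀ x, 0 < N x) (x : G.Outcome) : 0 < empirical N x :=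
  div_pos (Nat.cast_pos.2 (hN x)) (sum_counts_pos hN)

theorem sum_empirical (hN : ∀ x, 0 < N x) : ∑ x, empirical N x = 1 := by
  simp only [empirical, ← Finset.sum_div]
  exact div_self (sum_counts_pos hN).ne'

theorem isAlgorithmOutput_iff {α : G.Link → ℝ} : G.IsAlgorithmOutput N α ↔
    G.IsOutputFor (G.downFreq (empirical N)) (G.upFreq (empirical N)) α := by
  have e1 : G.down.freq (G.multicastCount N) = G.downFreq (empirical N) := by
    funext k
    rw [show G.downFreq (empirical N) k = _ from
      (LogicalTree.freq_eq_hitFreq (T := G.down) receiverMarks N k).symm]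
    congr 1
    funext y
    refine Finset.sum_congr rfl fun x _ => if_congr ?_ rfl rfl
    rw [funext_iff]
    refine forall_congr' fun r => ?_
    rw [← receiverMarks_eq_true]
    exact Bool.eq_iff_iff.symm
  have e2 : G.up.freq (G.reverseCount N) = G.upFreq (empirical N) := by
    funext k
    rw [show G.upFreq (empirical N) k = _ from
      (LogicalTree.freq_eq_hitFreq (T := G.up) sourceMarks N k).symm]
    congr 1
    funext y
    refine Finset.sum_congr rfl fun x _ => if_congr ?_ rfl rfl
    rw [funext_iff]
    refine forall_congr' fun r => ?_
    rw [← sourceMarks_eq_true]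
    exact Bool.eq_iff_iff.symm
  simp only [IsAlgorithmOutput, IsOutputFor, LogicalTree.isMINC_iff, e1, e2]

theorem existsUnique_algorithmOutput (hN : ∀ x, 0 < N x) :
    ∃! α : G.Link → ℝ, G.IsAlgorithmOutput N α := by
  simp only [isAlgorithmOutput_iff]
  exact existsUnique_output (regular_downFreq (empirical_pos hN))
    (regular_upFreq (empirical_pos hN))

theorem IsAlgorithmOutput.isMLE (hN : ∀ x, 0 < N x) {α : G.Link → ℝ}
    (h : G.IsAlgorithmOutput N α) (hα : α ∈ G.rates) :
    G.IsMLE N α ∧ ∀ β, G.IsMLE N β → β = α := by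
  have h' := isAlgorithmOutput_iff.1 h
  have hμ := empirical_pos hN
  have hsum := sum_empirical hN
  have hn := sum_counts_pos hN
  have hpos := h'.prob_pos hμ hsum hα
  obtain ⟨hd, hu⟩ := h'.hitFreq_eq (regular_downFreq hμ) (regular_upFreq hμ) (downFreq_D _)
  -- The empirical distribution and p(·; α) have equal hit frequencies, so they give the same
  -- expected log-likelihood of β.
  have hlog : ∀ β : G.Link → ℝ, (∀ x, 0 < G.prob β x) →
      ∑ x, (N x : ℝ) * Real.log (G.prob β x) =
        (∑ x, (N x : ℝ)) * ∑ x, G.prob α x * Real.log (G.prob β x) := by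
    intro β hβ
    rw [sum_mul_log_prob hβ (hsum ▸ sum_prob α) hd hu, Finset.mul_sum]
    refine Finset.sum_congr rfl fun x _ => ?_
    rw [empirical]
    field_simp
  have hL : 0 < G.likelihood N α := Finset.prod_pos fun x _ => pow_pos (hpos x) _
  have hgibbs : ∀ β : G.Link → ℝ, (∀ x, 0 < G.prob β x) → _ := fun β hβ =>
    sum_mul_log_le hpos hβ ((sum_prob α).trans (sum_prob β).symm)
  -- Every outcome was observed, so a rate vector on the boundary that excludes one has likelihood
  -- zero and cannot compete.
  have hpos_of : ∀ β ∈ G.rates, 0 < G.likelihood N β → ∀ x, 0 < G.prob β x := by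
    intro β hβ hLβ x
    refine lt_of_le_of_ne (prob_nonneg hβ x) fun e => hLβ.ne' ?_
    exact Finset.prod_eq_zero (Finset.mem_univ x) (by rw [← e, zero_pow (hN x).ne'])
  refine ⟨⟨hα, fun β hβ => ?_⟩, fun β hβ => ?_⟩
  · rcases (likelihood_nonneg hβ N).eq_or_lt with e | hLβ
    · rw [← e]
      exact hL.le
    · have hβpos := hpos_of β hβ hLβ
      rw [likelihood_eq_exp hβpos, likelihood_eq_exp hpos, hlog β hβpos, hlog α hpos]
      exact Real.exp_le_exp.2 (mul_le_mul_of_nonneg_left (hgibbs β hβpos).1 hn.le)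
  · have hβpos := hpos_of β hβ.1 (hL.trans_le (hβ.2 α hα))
    have hle := hβ.2 α hα
    rw [likelihood_eq_exp hβpos, likelihood_eq_exp hpos, hlog β hβpos, hlog α hpos,
      Real.exp_le_exp] at hle
    have hp := (hgibbs β hβpos).2 (le_of_mul_le_mul_left hle hn)
    have hout := isOutputFor_prob hβ.1 hβpos
    have hp' : G.prob β = G.prob α := hp
    rw [hp', show G.downFreq (G.prob α) = _ from hd, show G.upFreq (G.prob α) = _ from hu] at hout
    exact (existsUnique_algorithmOutput hN).unique (isAlgorithmOutput_iff.2 hout) h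

end CodedTree

/-! ### Consistency: the algorithm along a sequence of experiments -/

namespace CodedTree

open Classical

variable {U W : Type*} {G : CodedTree U W} [Fintype U] [Fintype W]

theorem tendsto_output {μ : ℕ → G.Outcome → ℝ} {μ₀ : G.Outcome → ℝ} {α : ℕ → G.Link → ℝ}
    {α₀ : G.Link → ℝ} (hμ₀ : ∀ x, 0 < μ₀ x)
    (h₀ : G.IsOutputFor (G.downFreq μ₀) (G.upFreq μ₀) α₀)
    (hμ : ∀ x, Tendsto (fun n => μ n x) atTop (nhds (μ₀ x)))
    (h : ∀ᶠ n in atTop, (∀ x, 0 < μ n x) ∧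
      G.IsOutputFor (G.downFreq (μ n)) (G.upFreq (μ n)) (α n)) (e : G.Link) :
    Tendsto (fun n => α n e) atTop (nhds (α₀ e)) := by
  have hd : ∀ k, Tendsto (fun n => G.downFreq (μ n) k) atTop (nhds (G.downFreq μ₀ k)) :=
    fun k => tendsto_finsetSum _ fun x _ => (hμ x).mul_const _
  have hu : ∀ k, Tendsto (fun n => G.upFreq (μ n) k) atTop (nhds (G.upFreq μ₀ k)) :=
    fun k => tendsto_finsetSum _ fun x _ => (hμ x).mul_const _
  obtain ⟨Am, hAm⟩ := (h.mono fun n hn => hn.2).choice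
  obtain ⟨am, ham⟩ := hAm.choice
  obtain ⟨Ar, hAr⟩ := ham.choice
  obtain ⟨ar, har⟩ := hAr.choice
  obtain ⟨Bm, bm, Br, br, b1, b2, b3, b4, b5⟩ := h₀
  have hm' : ∀ᶠ n in atTop, G.down.Regular (G.downFreq (μ n)) ∧
      G.down.IsMINCFor (G.downFreq (μ n)) (Am n) (am n) := by
    filter_upwards [h, har] with n h1 h2
    exact ⟨regular_downFreq h1.1, h2.1⟩
  have hr' : ∀ᶠ n in atTop, G.up.Regular (G.upFreq (μ n)) ∧
      G.up.IsMINCFor (G.upFreq (μ n)) (Ar n) (ar n) := by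
    filter_upwards [h, har] with n h1 h2
    exact ⟨regular_upFreq h1.1, h2.2.1⟩
  have rm := regular_downFreq hμ₀
  have rr := regular_upFreq hμ₀
  rcases e with k | _ | k
  · refine Tendsto.congr' ?_ ((b4 k).symm ▸ b2.tendsto_rate rr hr' hu k.1)
    filter_upwards [har] with n hn
    exact (hn.2.2.2.1 k).symm
  · change Tendsto _ _ (nhds (α₀ G.linkCD))
    rw [b5]
    refine Tendsto.congr' ?_ (((b2.tendsto_path rr hr' hu G.C).mul
      (b1.tendsto_path rm hm' hd G.D)).div (hd G.D) (rm.pos G.D).ne')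
    filter_upwards [har] with n hn
    exact hn.2.2.2.2.symm
  · refine Tendsto.congr' ?_ ((b3 k).symm ▸ b1.tendsto_rate rm hm' hd k.1)
    filter_upwards [har] with n hn
    exact (hn.2.2.1 k).symm

theorem sum_counts (X : ℕ → G.Outcome) (n : ℕ) : ∑ x, (G.counts X n x : ℝ) = n := by
  have h := Finset.card_eq_sum_card_fiberwise (s := Finset.range n) (t := Finset.univ)
    (f := X) fun _ _ => Finset.mem_coe.2 (Finset.mem_univ _)
  rw [Finset.card_range] at h
  rw [← Nat.cast_sum]
  refine congrArg Nat.cast (Eq.trans (Finset.sum_congr rfl fun x _ => ?_) h.symm)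
  exact congrArg Finset.card (Finset.filter_congr_decidable _ _ _)

theorem eventually_output {α₀ : G.Link → ℝ} (hα₀ : ∀ e, 0 < α₀ e ∧ α₀ e < 1)
    {X : ℕ → G.Outcome}
    (hX : ∀ x, Tendsto (fun n => (G.counts X n x : ℝ) / n) atTop (nhds (G.prob α₀ x))) :
    ∀ᶠ n in atTop, (∀ x, 0 < G.counts X n x) ∧
      ∃ α : G.Link → ℝ, G.IsAlgorithmOutput (G.counts X n) α ∧ α ∈ G.rates ∧
        G.IsMLE (G.counts X n) α ∧ ∀ β, G.IsMLE (G.counts X n) β → β = α := by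
  have hpos := prob_pos_of_lt_one hα₀
  have hN : ∀ᶠ n in atTop, ∀ x, 0 < G.counts X n x := by
    refine eventually_all.2 fun x => ?_
    filter_upwards [(hX x).eventually_const_lt (hpos x)] with n hn
    refine Nat.pos_of_ne_zero fun h => ?_
    rw [h, Nat.cast_zero, zero_div] at hn
    exact lt_irrefl _ hn
  have hout : ∀ n, ∃ α, (∀ x, 0 < G.counts X n x) → G.IsAlgorithmOutput (G.counts X n) α := by
    intro n
    by_cases h : ∀ x, 0 < G.counts X n x
    · exact (existsUnique_algorithmOutput h).exists.imp fun _ hα _ => hα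
    -- A dummy value while some outcome is still unobserved; only large n matter.
    · exact ⟨α₀, fun h' => absurd h' h⟩
  choose α hα using hout
  have ht := tendsto_output (μ := fun n => empirical (G.counts X n)) (α := α) hpos
    (isOutputFor_prob (fun e => ⟨(hα₀ e).1, (hα₀ e).2.le⟩) hpos)
    (fun x => by simpa only [empirical, sum_counts] using hX x)
    (hN.mono fun n hn => ⟨empirical_pos hn, isAlgorithmOutput_iff.1 (hα n hn)⟩)
  have hrates : ∀ᶠ n in atTop, α n ∈ G.rates := by
    refine eventually_all.2 fun e => ?_
    filter_upwards [(ht e).eventually_const_lt (hα₀ e).1, (ht e).eventually_lt_const (hα₀ e).2]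
      with n h1 h2
    exact ⟨h1, h2.le⟩
  filter_upwards [hN, hrates] with n h1 h2
  have h3 := hα n h1
  exact ⟨h1, α n, h3, h2, h3.isMLE h1 h2⟩

/-- The strong law for the indicator of each of the finitely many outcomes. -/
theorem ae_tendsto_counts {Ω : Type*} [MeasurableSpace Ω] {P : Measure Ω} [IsProbabilityMeasure P]
    {X : ℕ → Ω → G.Outcome} (hm : ∀ t, Measurable (X t)) (hi : iIndepFun X P)
    {q : G.Outcome → ℝ} (hq : ∀ t x, P.real (X t ⁻¹' {x}) = q x) :
    ∀ᵐ ω ∂P, ∀ x, Tendsto (fun n => (G.counts (fun t => X t ω) n x : ℝ) / n) atTop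
      (nhds (q x)) := by
  refine ae_all_iff.2 fun x => ?_
  let f : G.Outcome → ℝ := fun y => if y = x then 1 else 0
  have hf : Measurable f := 
    Measurable.ite (measurableSet_singleton x) measurable_const measurable_const
  have hmap : ∀ i, P.map (X i) = P.map (X 0) := by
    intro i
    refine Measure.ext_of_singleton fun y => ?_
    rw [Measure.map_apply (hm i) (measurableSet_singleton y),
      Measure.map_apply (hm 0) (measurableSet_singleton y)]
    exact (measureReal_eq_measureReal_iff).1 ((hq i y).trans (hq 0 y).symm)
  have hcomp : f ∘ X 0 = Set.indicator (X 0 ⁻¹' {x}) fun _ => (1 : ℝ) := by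
    funext ω
    simp [f, Set.indicator]
  have h := strong_law_ae_real (μ := P) (fun t => f ∘ X t)
    (by rw [hcomp]; exact (integrable_const 1).indicator (hm 0 (measurableSet_singleton x)))
    (fun i j hij => (hi.indepFun hij).comp hf hf)
    (fun i => IdentDistrib.comp ⟨(hm i).aemeasurable, (hm 0).aemeasurable, hmap i⟩ hf)
  have hE : P[f ∘ X 0] = q x := by
    rw [hcomp, integral_indicator_const _ (hm 0 (measurableSet_singleton x)), hq, smul_eq_mul,
      mul_one]
  rw [hE] at h
  filter_upwards [h] with ω hω
  refine hω.congr fun n => ?_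
  congr 1
  simp [f, counts]

end CodedTree

theorem mainTheorem3 {U W : Type*} [Fintype U] [Fintype W] (G : CodedTree U W) :
    (∀ N : G.Outcome → ℕ, (∀ x, 0 < N x) →
      (∃! α : G.Link → ℝ, G.IsAlgorithmOutput N α) ∧
      ∀ α : G.Link → ℝ, G.IsAlgorithmOutput N α → α ∈ G.rates →
        G.IsMLE N α ∧ ∀ β, G.IsMLE N β → β = α) ∧
    (∀ α₀ : G.Link → ℝ, (∀ e, 0 < α₀ e ∧ α₀ e < 1) →
      ∀ {Ω : Type*} [MeasurableSpace Ω] (P : Measure Ω) [IsProbabilityMeasure P]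
        (X : ℕ → Ω → G.Outcome),
        (∀ t, Measurable (X t)) → iIndepFun X P →
        (∀ t x, P.real (X t ⁻¹' {x}) = G.prob α₀ x) →
        ∀ᵐ ω ∂P, ∀ᶠ n in atTop,
          (∀ x, 0 < G.counts (fun t => X t ω) n x) ∧
          ∃ α : G.Link → ℝ, G.IsAlgorithmOutput (G.counts (fun t => X t ω) n) α ∧
            α ∈ G.rates ∧
            G.IsMLE (G.counts (fun t => X t ω) n) α ∧
            ∀ β, G.IsMLE (G.counts (fun t => X t ω) n) β → β = α) := by
  exact ⟨fun N hN => ⟨CodedTree.existsUnique_algorithmOutput hN, fun α h hα => h.isMLE hN hα⟩,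
    fun α₀ hα₀ _ _ P _ X hm hi hq =>
      (CodedTree.ae_tendsto_counts hm hi hq).mono fun _ hω => CodedTree.eventually_output hα₀ hω⟩
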